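/- **Setting.** Let $B_2\subset B_1\subset B$ be real Banach spaces with norms $\|\cdot\|_2\ge\|\cdot\|_1\ge\|\cdot\|$, $B_2$ being dense in $B_1$ and $B_1$ dense in $B$, and let $B^{par}$ be another Banach space. Assume the following conditions (A). (i) $D=(D_1,\dots,D_n)$ with $D_j\in\mathcal L(B_1,B)\cap\mathcal L(B_2,B_1)$, the norms of $D_j$ in both spaces being at most $1$. (ii) $A\in\mathcal L(B_2,B)$ generates a strongly continuous semigroup $e^{At}$ in $B$ that restricts to a strongly continuous semigroup in $B_1$, with $\|e^{At}\|_{B\to B}\le Me^{mt}$ and $\|e^{At}\|_{B_1\to B_1}\le M_1e^{m_1t}$ for all $t\ge 0$ and some nonnegative constants $M,m,M_1,m_1$, and $B_2$ is an invariant core of this semigroup in $B$. (iii) $H:\mathbb R\times B\times B^n\times B^{par}\to B$ is continuous and, with some constants $L_H,L_H',L_H^{par}\ge0$, $$\|H(t,b_0,\dots,b_n,\alpha)-H(t,\tilde b_0,\dots,\tilde b_n,\alpha)\|\le L_H\sum_{j=0}^n\|b_j-\tilde b_j\|\Bigl(1+L_H'\sum_{j=1}^n\|b_j\|\Bigr),$$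 $$\|H(t,b_0,\dots,b_n,\alpha)-H(t,b_0,\dots,b_n,\tilde\alpha)\|\le L_H^{par}\|\alpha-\tilde\alpha\|_{par}\Bigl(1+\sum_{j=1}^n\|b_j\|\Bigr),$$ $$\|H(t,b_0,\dots,b_n,\alpha)\|\le L_H\sum_{j=1}^n\|b_j\|.$$ Assume also the smoothing property: for $t>0$ the operator $e^{At}$ takes $B$ to $B_1$, and $\|e^{At}\|_{B\to B_1}\le\kappa t^{-\omega}$ for $t\in(0,1]$, with some $\kappa>0$ and $\omega\in(0,1)$. For $\beta\in(0,1)$ let $G_\beta(t,x)=\frac1\pi\,\mathrm{Re}\int_0^\infty\exp\{ipx-tp^\beta e^{i\pi\beta/2}\}\,dp$ and, for $\tau\ge0$, $v\in B$, $$E_\beta(\tau A)v=\frac1\beta\int_0^\infty x^{-1-1/\beta}G_\beta(1,x^{-1/\beta})\,e^{A\tau x}v\,dx,\qquad E_\beta'(\tau A)v=\frac1\beta\int_0^\infty x^{-1/\beta}G_\beta(1,x^{-1/\beta})\,e^{A\tau x}v\,dx.$$ Let $C([a,T],B_1)$ carry the norm $\|b(\cdot)\|_{C([a,T],B_1)}=\sup_{t\in[a,T]}\|b(t)\|_1$.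 For $u:\mathbb R\times C([a,T],B_1)\to B^{par}$ consider the anticipating equations $$\dot b(t)=Ab(t)+H(t,b(t),Db(t),u(t,b(\cdot))),\qquad D^\beta_{a+*}b(t)=Ab(t)+H(t,b(t),Db(t),u(t,b(\cdot)))\qquad (t\in[a,T],\ b(a)=Y),$$ with $D^\beta_{a+*}$ the Caputo–Dzherbashyan derivative of order $\beta$. Their mild solutions are by definition the curves $b\in C([a,T],B_1)$ with $b(a)=Y$ such that, for all $t\in[a,T]$, respectively $$b(t)=e^{A(t-a)}Y+\int_a^te^{A(t-s)}H(s,b(s),Db(s),u(s,b(\cdot)))\,ds,$$ $$b(t)=E_\beta(A(t-a)^\beta)Y+\beta\int_a^t(t-s)^{\beta-1}E_\beta'(A(t-s)^\beta)H(s,b(s),Db(s),u(s,b(\cdot)))\,ds.$$ **Theorem.** Under these assumptions, for every $\beta\in(0,1)$, $a\in\mathbb R$, $L_u$ and $r>0$ there exist $T_0>a$ and $K\ge0$ such that the following holds for every $T\in(a,T_0)$ and every continuous $u:\mathbb R\times C([a,T],B_1)\to B^{par}$ with $$\|u(t,b(\cdot))-u(t,\tilde b(\cdot))\|_{par}\le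 L_u\|b(\cdot)-\tilde b(\cdot)\|_{C([a,T],B_1)}.$$ For every $Y\in B_1$ with $\|Y\|_1\le r$ each of the two equations has a unique mild solution $b(\cdot\,;Y)$ in $C([a,T],B_1)$, and for each of them $$\sup_{t\in[a,T]}\|b(t;Y)-b(t;\tilde Y)\|_1\le K\|Y-\tilde Y\|_1\qquad\text{whenever }\|Y\|_1,\|\tilde Y\|_1\le r.$$ -/

import Mathlib

open MeasureTheory Filter Topology Set

noncomputable section

/-- A Banach triple `B₂ ⊂ B₁ ⊂ B`: the inclusions are injective linear maps that do not increase
the norm (`‖x‖ ≤ ‖x‖₁ ≤ ‖x‖₂`) and have dense range. -/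
structure BanachTriple (B₂ B₁ B : Type*)
    [NormedAddCommGroup B₂] [NormedSpace ℝ B₂] [CompleteSpace B₂]
    [NormedAddCommGroup B₁] [NormedSpace ℝ B₁] [CompleteSpace B₁]
    [NormedAddCommGroup B] [NormedSpace ℝ B] [CompleteSpace B] where
  /-- the inclusion `B₂ ⊂ B₁` -/
  incl₂ : B₂ →L[ℝ] B₁
  /-- the inclusion `B₁ ⊂ B` -/
  incl₁ : B₁ →L[ℝ] B
  incl₂_injective : Function.Injective incl₂
  incl₁_injective : Function.Injective incl₁
  norm_incl₂_le : ∀ x, ‖incl₂ x‖ ≤ ‖x‖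
  norm_incl₁_le : ∀ x, ‖incl₁ x‖ ≤ ‖x‖
  denseRange_incl₂ : DenseRange incl₂
  denseRange_incl₁ : DenseRange incl₁

/-- A strongly continuous one-parameter semigroup of bounded operators on `E`.  Only the operators
with nonnegative time are meaningful. -/
structure C0Semigroup (E : Type*) [NormedAddCommGroup E] [NormedSpace ℝ E] where
  /-- the operator at time `t` -/
  op : ℝ → E →L[ℝ] E
  op_zero : op 0 = ContinuousLinearMap.id ℝ E
  op_add : ∀ s t, 0 ≤ s → 0 ≤ t → op (s + t) = (op s).comp (op t)
  strongly_continuous : ∀ v, ContinuousOn (fun t => op t v) (Ici 0)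

/-- `v` belongs to the domain of the infinitesimal generator of `S`, whose value at `v` is `w`. -/
def C0Semigroup.HasGenerator {E : Type*} [NormedAddCommGroup E] [NormedSpace ℝ E]
    (S : C0Semigroup E) (v w : E) : Prop :=
  Tendsto (fun h : ℝ => h⁻¹ • (S.op h v - v)) (𝓝[>] 0) (𝓝 w)

/-- The operator `A ∈ L(B₂, B)` generates the strongly continuous semigroup `S = e^{At}` in `B`,
which restricts to the strongly continuous semigroup `S₁` in `B₁`, both are exponentially bounded,
and `B₂` is an invariant core for `S` in `B`. -/
structure GeneratesOnTriple {B₂ B₁ B : Type*}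
    [NormedAddCommGroup B₂] [NormedSpace ℝ B₂] [CompleteSpace B₂]
    [NormedAddCommGroup B₁] [NormedSpace ℝ B₁] [CompleteSpace B₁]
    [NormedAddCommGroup B] [NormedSpace ℝ B] [CompleteSpace B]
    (E : BanachTriple B₂ B₁ B) (A : B₂ →L[ℝ] B) (S : C0Semigroup B) (S₁ : C0Semigroup B₁) :
    Prop where
  generator : ∀ v : B₂, S.HasGenerator (E.incl₁ (E.incl₂ v)) (A v)
  restrict : ∀ t, 0 ≤ t → ∀ v : B₁, E.incl₁ (S₁.op t v) = S.op t (E.incl₁ v)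
  growth : ∃ M m : ℝ, 0 ≤ M ∧ 0 ≤ m ∧ ∀ t, 0 ≤ t → ‖S.op t‖ ≤ M * Real.exp (m * t)
  growth₁ : ∃ M₁ m₁ : ℝ, 0 ≤ M₁ ∧ 0 ≤ m₁ ∧ ∀ t, 0 ≤ t → ‖S₁.op t‖ ≤ M₁ * Real.exp (m₁ * t)
  invariant : ∀ t, 0 ≤ t → ∀ v : B₂, ∃ w : B₂,
    E.incl₁ (E.incl₂ w) = S.op t (E.incl₁ (E.incl₂ v))
  core : ∀ v w : B, S.HasGenerator v w → ∀ ε > 0, ∃ z : B₂,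
    ‖E.incl₁ (E.incl₂ z) - v‖ < ε ∧ ‖A z - w‖ < ε

/-- `H : ℝ × B × Bⁿ × P → B` is continuous, locally Lipschitz in the `B`-arguments with a Lipschitz
constant of linear growth, Lipschitz in the parameter, and of linear growth. -/
structure HamiltonianCond {B P : Type*}
    [NormedAddCommGroup B] [NormedSpace ℝ B] [NormedAddCommGroup P] [NormedSpace ℝ P]
    {n : ℕ} (H : ℝ → B → (Fin n → B) → P → B) : Prop where
  continuous : Continuous fun p : ℝ × B × (Fin n → B) × P => H p.1 p.2.1 p.2.2.1 p.2.2.2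
  bounds : ∃ L L' Lpar : ℝ, 0 ≤ L ∧ 0 ≤ L' ∧ 0 ≤ Lpar ∧
    (∀ t b₀ b c₀ c α, ‖H t b₀ b α - H t c₀ c α‖ ≤
      L * (‖b₀ - c₀‖ + ∑ j, ‖b j - c j‖) * (1 + L' * ∑ j, ‖b j‖)) ∧
    (∀ t b₀ b α α', ‖H t b₀ b α - H t b₀ b α'‖ ≤ Lpar * ‖α - α'‖ * (1 + ∑ j, ‖b j‖)) ∧
    (∀ t b₀ b α, ‖H t b₀ b α‖ ≤ L * ∑ j, ‖b j‖)

/-- Conditions (A): a Banach triple, operators `D_j ∈ L(B₁, B) ∩ L(B₂, B₁)` with norms at most one,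
the generator `A` of the semigroup `e^{At}` in `B` and `B₁`, and the nonlinearity `H`. -/
structure ConditionsA {B₂ B₁ B P : Type*}
    [NormedAddCommGroup B₂] [NormedSpace ℝ B₂] [CompleteSpace B₂]
    [NormedAddCommGroup B₁] [NormedSpace ℝ B₁] [CompleteSpace B₁]
    [NormedAddCommGroup B] [NormedSpace ℝ B] [CompleteSpace B]
    [NormedAddCommGroup P] [NormedSpace ℝ P]
    {n : ℕ} (E : BanachTriple B₂ B₁ B) (D : Fin n → B₁ →L[ℝ] B) (A : B₂ →L[ℝ] B)
    (S : C0Semigroup B) (S₁ : C0Semigroup B₁) (H : ℝ → B → (Fin n → B) → P → B) : Prop where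
  norm_D_le : ∀ j, ‖D j‖ ≤ 1
  D_restrict : ∀ j, ∃ D₂ : B₂ →L[ℝ] B₁, ‖D₂‖ ≤ 1 ∧ ∀ v, E.incl₁ (D₂ v) = D j (E.incl₂ v)
  semigroup : GeneratesOnTriple E A S S₁
  hamiltonian : HamiltonianCond H

/-- The smoothing property: for `t > 0` the operator `e^{At}` takes `B` to `B₁`, and
`‖e^{At}‖_{B → B₁} ≤ κ t^{-ω}` for `t ∈ (0, 1]`, with some `κ > 0` and `ω ∈ (0, 1)`. -/
def IsSmoothing {B₂ B₁ B : Type*}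
    [NormedAddCommGroup B₂] [NormedSpace ℝ B₂] [CompleteSpace B₂]
    [NormedAddCommGroup B₁] [NormedSpace ℝ B₁] [CompleteSpace B₁]
    [NormedAddCommGroup B] [NormedSpace ℝ B] [CompleteSpace B]
    (E : BanachTriple B₂ B₁ B) (S : C0Semigroup B) : Prop :=
  ∃ κ ω : ℝ, 0 < κ ∧ 0 < ω ∧ ω < 1 ∧ ∀ t, 0 < t → ∀ v : B, ∃ w : B₁,
    E.incl₁ w = S.op t v ∧ (t ≤ 1 → ‖w‖ ≤ κ * t ^ (-ω) * ‖v‖)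

/-- The density
`G_β(t, x) = π⁻¹ Re ∫_0^∞ exp (i p x - t p^β e^{iπβ/2}) dp` of the `β`-stable subordinator. -/
def stableDensity (β t x : ℝ) : ℝ :=
  (1 / Real.pi) * (∫ p in Ioi (0 : ℝ), Complex.exp (Complex.I * p * x -
    t * ((p ^ β : ℝ) : ℂ) * Complex.exp (Complex.I * Real.pi * β / 2))).re

/-- The vector `E_β(τ A) v`, `τ ≥ 0`, where `E_β` is the Mittag-Leffler function and `S = e^{At}`:
`E_β(τ A) v = β⁻¹ ∫_0^∞ x^{-1-1/β} G_β(1, x^{-1/β}) e^{τ x A} v dx`. -/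
def mittagLeffler {B : Type*} [NormedAddCommGroup B] [NormedSpace ℝ B]
    (S : C0Semigroup B) (β τ : ℝ) (v : B) : B :=
  (1 / β) • ∫ x in Ioi (0 : ℝ),
    (x ^ (-1 - 1 / β) * stableDensity β 1 (x ^ (-1 / β))) • S.op (τ * x) v

/-- The vector `E_β'(τ A) v`, `τ ≥ 0`, where `E_β'` is the derivative of the Mittag-Leffler
function and `S = e^{At}`: `E_β'(τ A) v = β⁻¹ ∫_0^∞ x^{-1/β} G_β(1, x^{-1/β}) e^{τ x A} v dx`. -/
def mittagLefflerDeriv {B : Type*} [NormedAddCommGroup B] [NormedSpace ℝ B]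
    (S : C0Semigroup B) (β τ : ℝ) (v : B) : B :=
  (1 / β) • ∫ x in Ioi (0 : ℝ),
    (x ^ (-1 / β) * stableDensity β 1 (x ^ (-1 / β))) • S.op (τ * x) v

section Mild

variable {B₂ B₁ B P : Type*}
  [NormedAddCommGroup B₂] [NormedSpace ℝ B₂] [CompleteSpace B₂]
  [NormedAddCommGroup B₁] [NormedSpace ℝ B₁] [CompleteSpace B₁]
  [NormedAddCommGroup B] [NormedSpace ℝ B] [CompleteSpace B]
  [NormedAddCommGroup P] [NormedSpace ℝ P] {n : ℕ}

/-- The curve `s ↦ H(s, b(s), D b(s), u(s, b(·)))` in `B`, for `s ∈ [a, T]`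
(for other `s` the curve `b` is extended by its end values, which is never used). -/
def nonlinearity (E : BanachTriple B₂ B₁ B) (D : Fin n → B₁ →L[ℝ] B)
    (H : ℝ → B → (Fin n → B) → P → B) {a T : ℝ} (haT : a ≤ T)
    (u : ℝ → C(Icc a T, B₁) → P) (b : C(Icc a T, B₁)) (s : ℝ) : B :=
  H s (E.incl₁ (b (projIcc a T haT s))) (fun j => D j (b (projIcc a T haT s))) (u s b)

/-- The value at time `t` of
`Φ_Y(b)(t) = e^{A(t-a)} Y + ∫_a^t e^{A(t-s)} H(s, b(s), D b(s), u(s, b(·))) ds`. -/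
def classicalMap (E : BanachTriple B₂ B₁ B) (D : Fin n → B₁ →L[ℝ] B) (S : C0Semigroup B)
    (H : ℝ → B → (Fin n → B) → P → B) {a T : ℝ} (haT : a ≤ T)
    (u : ℝ → C(Icc a T, B₁) → P) (Y : B₁) (b : C(Icc a T, B₁)) (t : ℝ) : B :=
  S.op (t - a) (E.incl₁ Y) + ∫ s in a..t, S.op (t - s) (nonlinearity E D H haT u b s)

/-- The value at time `t` of `Φ_Y(b)(t) = E_β(A(t-a)^β) Y
+ β ∫_a^t (t-s)^{β-1} E_β'(A(t-s)^β) H(s, b(s), D b(s), u(s, b(·))) ds`. -/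
def fractionalMap (E : BanachTriple B₂ B₁ B) (D : Fin n → B₁ →L[ℝ] B) (S : C0Semigroup B)
    (β : ℝ) (H : ℝ → B → (Fin n → B) → P → B) {a T : ℝ} (haT : a ≤ T)
    (u : ℝ → C(Icc a T, B₁) → P) (Y : B₁) (b : C(Icc a T, B₁)) (t : ℝ) : B :=
  mittagLeffler S β ((t - a) ^ β) (E.incl₁ Y) +
    β • ∫ s in a..t, (t - s) ^ (β - 1) •
      mittagLefflerDeriv S β ((t - s) ^ β) (nonlinearity E D H haT u b s)

/-- `b ∈ C([a, T], B₁)` is a mild solution, with `b(a) = Y`, of the anticipating equation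
`b' = A b + H(t, b, D b, u(t, b(·)))`. -/
def IsMildSolution (E : BanachTriple B₂ B₁ B) (D : Fin n → B₁ →L[ℝ] B) (S : C0Semigroup B)
    (H : ℝ → B → (Fin n → B) → P → B) {a T : ℝ} (haT : a ≤ T)
    (u : ℝ → C(Icc a T, B₁) → P) (Y : B₁) (b : C(Icc a T, B₁)) : Prop :=
  b ⟨a, left_mem_Icc.2 haT⟩ = Y ∧
    ∀ t : Icc a T, E.incl₁ (b t) = classicalMap E D S H haT u Y b t

/-- `b ∈ C([a, T], B₁)` is a mild solution, with `b(a) = Y`, of the anticipating equation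
`D^β_{a+*} b = A b + H(t, b, D b, u(t, b(·)))` with the Caputo-Dzherbashyan derivative. -/
def IsFractionalMildSolution (E : BanachTriple B₂ B₁ B) (D : Fin n → B₁ →L[ℝ] B)
    (S : C0Semigroup B) (β : ℝ) (H : ℝ → B → (Fin n → B) → P → B) {a T : ℝ} (haT : a ≤ T)
    (u : ℝ → C(Icc a T, B₁) → P) (Y : B₁) (b : C(Icc a T, B₁)) : Prop :=
  b ⟨a, left_mem_Icc.2 haT⟩ = Y ∧
    ∀ t : Icc a T, E.incl₁ (b t) = fractionalMap E D S β H haT u Y b t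

end Mild

end

/-! Both mild equations are Volterra equations b(t) = P(t-a)Y + ∫ K(t-s) N(b)(s) ds in B₁, whose
kernel maps B to B₁ with norm at most C t^(-γ), γ < 1: γ = ω in the classical case, γ = 1 - β + βω
in the fractional one. On an interval of length δ the integral gains a factor of order δ^(1-γ). For
small δ the linear growth of N gives ‖b‖ ≤ Cr + ‖b‖/2, so every solution lies in the ball of radius
2Cr. There N is Lipschitz, and the Picard map preserves the ball and contracts by 1/2. Hence
existence, uniqueness among all curves, and the Lipschitz constant 2C in the initial value
(`volterra_wellPosed`).

The fractional kernels are averages of the semigroup against w(x) = x^(-1-1/β) G_β(1, x^(-1/β)).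
This weight must outweigh the exponential growth of the semigroup, stay bounded at 0, and have mass
β, so that E_β(0) is the identity. Contour integration supplies the bounds: moving the vertical line
of integration gives the decay of G_β at 0 and its vanishing on the negative axis
(`exists_abs_stableDensity_le`), and rotating the ray gives the tail y^(-1-β)
(`exists_abs_stableDensity_le_rpow`). The mass comes from Fourier inversion
(`integral_stableDensity`). Positivity of G_β is never needed.

The mild equations are stated in B. Smoothing lifts the kernels to B₁, and injectivity of B₁ → B
makes the two formulations equivalent (`isVolterraSolution_iff`). -/

set_option linter.unusedSectionVars false

/-! ### Volterra equations with a weakly singular kernel -/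

section Volterra

/-- A strongly continuous family of additive maps on `(0, 1]` with an integrable singularity of
order `γ` at zero. -/
structure SingularKernel {F X : Type*} [NormedAddCommGroup F] [NormedAddCommGroup X]
    (K : ℝ → F → X) (C γ : ℝ) : Prop where
  map_sub : ∀ t ∈ Ioc (0 : ℝ) 1, ∀ v w, K t (v - w) = K t v - K t w
  bound : ∀ t ∈ Ioc (0 : ℝ) 1, ∀ v, ‖K t v‖ ≤ C * t ^ (-γ) * ‖v‖
  continuousOn : ∀ v, ContinuousOn (fun t => K t v) (Ioc 0 1)
  nonneg : 0 ≤ C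
  lt_one : γ < 1

variable {F X : Type*} [NormedAddCommGroup F] [NormedAddCommGroup X] [NormedSpace ℝ X]
  {K : ℝ → F → X} {C γ : ℝ}

namespace SingularKernel

theorem continuous_apply (hK : SingularKernel K C γ) {t : ℝ} (ht : t ∈ Ioc (0 : ℝ) 1) :
    Continuous (K t) := by
  have hLip : LipschitzWith (Real.toNNReal (C * t ^ (-γ))) (K t) := by
    refine LipschitzWith.of_dist_le_mul fun v w => ?_
    rw [dist_eq_norm, dist_eq_norm, ← hK.map_sub t ht, Real.coe_toNNReal _
      (mul_nonneg hK.nonneg (Real.rpow_nonneg ht.1.le _))]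
    exact hK.bound t ht _
  exact hLip.continuous

/-- Strong continuity treats a fixed vector only. The moving vector is handled by K σ (g σ - g σ₀) +
(K σ (g σ₀) - K σ₀ (g σ₀)), the operator bound being locally uniform away from 0. -/
theorem continuousOn_comp (hK : SingularKernel K C γ) {g : ℝ → F} (hg : Continuous g) :
    ContinuousOn (fun σ => K σ (g σ)) (Ioc 0 1) := by
  intro σ₀ h₀
  have h1 : Tendsto (fun σ => C * σ ^ (-γ) * ‖g σ - g σ₀‖ + ‖K σ (g σ₀) - K σ₀ (g σ₀)‖)
      (𝓝[Ioc 0 1] σ₀) (𝓝 0) := by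
    have e1 : Tendsto (fun σ : ℝ => C * σ ^ (-γ)) (𝓝[Ioc 0 1] σ₀) (𝓝 (C * σ₀ ^ (-γ))) :=
      ((Real.continuousAt_rpow_const σ₀ (-γ) (Or.inl h₀.1.ne')).tendsto.const_mul C).mono_left
        nhdsWithin_le_nhds
    have e2 : Tendsto (fun σ => ‖g σ - g σ₀‖) (𝓝[Ioc 0 1] σ₀) (𝓝 0) := by
      have := (tendsto_iff_norm_sub_tendsto_zero.1 (hg.tendsto σ₀))
      exact this.mono_left nhdsWithin_le_nhds
    have e3 := tendsto_iff_norm_sub_tendsto_zero.1 (hK.continuousOn (g σ₀) σ₀ h₀).tendsto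
    simpa using (e1.mul e2).add e3
  refine tendsto_iff_norm_sub_tendsto_zero.2 (squeeze_zero' (Eventually.of_forall fun _ =>
    norm_nonneg _) ?_ h1)
  filter_upwards [self_mem_nhdsWithin] with σ hσ
  calc ‖K σ (g σ) - K σ₀ (g σ₀)‖
      = ‖K σ (g σ - g σ₀) + (K σ (g σ₀) - K σ₀ (g σ₀))‖ := by
        rw [hK.map_sub σ hσ]; congr 1; abel
    _ ≤ _ := (norm_add_le _ _).trans (add_le_add_left (hK.bound σ hσ _) _)

theorem integrableOn_comp (hK : SingularKernel K C γ) {g : ℝ → F} (hg : Continuous g) {Q : ℝ}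
    (hQ : ∀ s, ‖g s‖ ≤ Q) : IntegrableOn (fun σ => K σ (g σ)) (Ioc 0 1) := by
  have hpow : IntegrableOn (fun σ : ℝ => C * Q * σ ^ (-γ)) (Ioc 0 1) := by
    have := (intervalIntegral.intervalIntegrable_rpow' (a := 0) (b := 1) (r := -γ)
      (by linarith [hK.lt_one])).const_mul (C * Q)
    exact (intervalIntegrable_iff_integrableOn_Ioc_of_le zero_le_one).1 this
  refine Integrable.mono' hpow
    ((hK.continuousOn_comp hg).aestronglyMeasurable measurableSet_Ioc) ?_
  filter_upwards [ae_restrict_mem measurableSet_Ioc] with σ hσ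
  have h2 : 0 ≤ C * σ ^ (-γ) := mul_nonneg hK.nonneg (Real.rpow_nonneg hσ.1.le _)
  calc _ ≤ C * σ ^ (-γ) * ‖g σ‖ := hK.bound σ hσ _
    _ ≤ C * σ ^ (-γ) * Q := by gcongr; exact hQ σ
    _ = _ := by ring

/-- Substituting σ = t - s pins the singularity at 0, so that one dominating function serves all t.
-/
theorem integral_eq (t a : ℝ) (f : ℝ → F) :
    ∫ s in a..t, K (t - s) (f s) = ∫ σ in (0 : ℝ)..(t - a), K σ (f (t - σ)) := by
  have := intervalIntegral.integral_comp_sub_left (a := a) (b := t)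
    (fun σ => K σ (f (t - σ))) t
  simpa using this

theorem intervalIntegrable (hK : SingularKernel K C γ) {f : ℝ → F} (hf : Continuous f) {Q : ℝ}
    (hQ : ∀ s, ‖f s‖ ≤ Q) {a t : ℝ} (h0 : a ≤ t) (h1 : t ≤ a + 1) :
    IntervalIntegrable (fun s => K (t - s) (f s)) volume a t := by
  have h2 : IntervalIntegrable (fun σ => K σ (f (t - σ))) volume 0 (t - a) := by
    rw [intervalIntegrable_iff_integrableOn_Ioc_of_le (by linarith)]
    exact (hK.integrableOn_comp (hf.comp (continuous_sub_left t)) (fun s => hQ _)).mono_set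
      (Ioc_subset_Ioc_right (by linarith))
  have h3 := (h2.comp_sub_left t).symm
  simpa using h3

theorem norm_integral_le (hK : SingularKernel K C γ) {f : ℝ → F} {Q : ℝ}
    (hQ : ∀ s, ‖f s‖ ≤ Q) {a t : ℝ} (h0 : a ≤ t) (h1 : t ≤ a + 1) :
    ‖∫ s in a..t, K (t - s) (f s)‖ ≤ C * Q * ((t - a) ^ (1 - γ) / (1 - γ)) := by
  rw [integral_eq]
  have hγ := hK.lt_one
  have hint : ∫ σ in (0 : ℝ)..(t - a), C * Q * σ ^ (-γ)
      = C * Q * ((t - a) ^ (1 - γ) / (1 - γ)) := by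
    rw [intervalIntegral.integral_const_mul, integral_rpow (Or.inl (by linarith)),
      Real.zero_rpow (by linarith), sub_zero, neg_add_eq_sub]
  rw [← hint]
  refine intervalIntegral.norm_integral_le_of_norm_le (by linarith) ?_
    ((intervalIntegral.intervalIntegrable_rpow' (by linarith)).const_mul _)
  refine Eventually.of_forall fun σ hσ => ?_
  have h2 : 0 ≤ C * σ ^ (-γ) := mul_nonneg hK.nonneg (Real.rpow_nonneg hσ.1.le _)
  calc _ ≤ C * σ ^ (-γ) * ‖f (t - σ)‖ := hK.bound σ ⟨hσ.1, by linarith [hσ.2]⟩ _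
    _ ≤ C * σ ^ (-γ) * Q := by gcongr; exact hQ _
    _ = _ := by ring

/-- Dominated convergence on the fixed interval (0, 1], the upper limit being carried by an
indicator. The indicator jumps at σ = t₀ - a only, a null set. -/
theorem continuousOn_integral (hK : SingularKernel K C γ) {f : ℝ → F} (hf : Continuous f) {Q : ℝ}
    (hQ : ∀ s, ‖f s‖ ≤ Q) (a : ℝ) :
    ContinuousOn (fun t => ∫ s in a..t, K (t - s) (f s)) (Icc a (a + 1)) := by
  have hγ := hK.lt_one
  set Ψ : ℝ → ℝ → X := fun t σ => (Ioc 0 (t - a)).indicator (fun σ => K σ (f (t - σ))) σ with hΨ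
  have key : ContinuousOn (fun t => ∫ σ in Ioc (0 : ℝ) 1, Ψ t σ) (Icc a (a + 1)) := by
    intro t₀ ht₀
    refine continuousWithinAt_of_dominated (bound := fun σ : ℝ => C * Q * σ ^ (-γ)) ?_ ?_ ?_ ?_
    · refine Eventually.of_forall fun t => ?_
      exact ((hK.integrableOn_comp (hf.comp (continuous_sub_left t)) (fun s => hQ _)).1.indicator
        measurableSet_Ioc)
    · refine Eventually.of_forall fun t => ?_
      filter_upwards [ae_restrict_mem measurableSet_Ioc] with σ hσ
      have h2 : 0 ≤ C * σ ^ (-γ) := mul_nonneg hK.nonneg (Real.rpow_nonneg hσ.1.le _)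
      have h3 : 0 ≤ Q := (norm_nonneg _).trans (hQ 0)
      refine (norm_indicator_le_norm_self _ _).trans ?_
      calc _ ≤ C * σ ^ (-γ) * ‖f (t - σ)‖ := hK.bound σ hσ _
        _ ≤ C * σ ^ (-γ) * Q := by gcongr; exact hQ _
        _ = _ := by ring
    · have := (intervalIntegral.intervalIntegrable_rpow' (a := 0) (b := 1) (r := -γ)
        (by linarith)).const_mul (C * Q)
      exact (intervalIntegrable_iff_integrableOn_Ioc_of_le zero_le_one).1 this
    · have hne : ∀ᵐ σ ∂(volume.restrict (Ioc (0 : ℝ) 1)), σ ≠ t₀ - a :=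
        ae_restrict_of_ae (by simp [ae_iff])
      filter_upwards [ae_restrict_mem measurableSet_Ioc, hne] with σ hσ hσ'
      rcases lt_or_gt_of_ne hσ' with h | h
      · have hc : ContinuousAt (fun t => K σ (f (t - σ))) t₀ :=
          ((hK.continuous_apply hσ).comp (hf.comp (continuous_sub_right σ))).continuousAt
        refine (hc.congr ?_).continuousWithinAt
        filter_upwards [lt_mem_nhds (show a + σ < t₀ by linarith)] with t ht
        simp only [hΨ]
        rw [indicator_of_mem (show σ ∈ Ioc 0 (t - a) from ⟨hσ.1, by linarith⟩)]
      · refine ((continuousAt_const (y := (0 : X))).congr ?_).continuousWithinAt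
        filter_upwards [gt_mem_nhds (show t₀ < a + σ by linarith)] with t ht
        simp only [hΨ]
        rw [indicator_of_notMem (fun hh : σ ∈ Ioc 0 (t - a) => by linarith [hh.2])]
  refine key.congr fun t ht => ?_
  simp only [hΨ]
  rw [integral_eq, intervalIntegral.integral_of_le (by linarith [ht.1]),
    setIntegral_indicator measurableSet_Ioc]
  congr 2
  ext σ
  simp only [mem_inter_iff, mem_Ioc]
  constructor
  · intro h; exact ⟨⟨h.1, by linarith [ht.2, h.2]⟩, h⟩
  · exact fun h => h.2

end SingularKernel

/-- `b` solves the Volterra equation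
`b(t) = P(t - a) Y + ∫_a^t K(t - s) N(b)(s) ds` on `[a, T]`. -/
def IsVolterraSolution (P : ℝ → X → X) (K : ℝ → F → X) {a T : ℝ}
    (N : C(Icc a T, X) → ℝ → F) (Y : X) (b : C(Icc a T, X)) : Prop :=
  ∀ t : Icc a T, b t = P (t - a) Y + ∫ s in a..t, K (t - s) (N b s)

/-- A family of additive maps, bounded by `C` and strongly continuous on `[0, 1]`. -/
structure BoundedPropagator (P : ℝ → X → X) (C : ℝ) : Prop where
  map_sub : ∀ t ∈ Icc (0 : ℝ) 1, ∀ v w, P t (v - w) = P t v - P t w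
  bound : ∀ t ∈ Icc (0 : ℝ) 1, ∀ v, ‖P t v‖ ≤ C * ‖v‖
  continuousOn : ∀ v, ContinuousOn (fun t => P t v) (Icc 0 1)

theorem exists_small_pow {γ : ℝ} (hγ : γ < 1) (A : ℝ) :
    ∃ δ : ℝ, 0 < δ ∧ δ ≤ 1 ∧ ∀ τ, 0 ≤ τ → τ ≤ δ → A * (τ ^ (1 - γ) / (1 - γ)) ≤ 1 / 2 := by
  have hc : Tendsto (fun τ : ℝ => |A| * (τ ^ (1 - γ) / (1 - γ))) (𝓝 0) (𝓝 0) := by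
    have := ((Real.continuousAt_rpow_const 0 (1 - γ) (Or.inr (by linarith))).tendsto.div_const
      (1 - γ)).const_mul |A|
    rwa [Real.zero_rpow (by linarith), zero_div, mul_zero] at this
  obtain ⟨ε, hε, hε'⟩ := Metric.eventually_nhds_iff.1
    (hc.eventually (gt_mem_nhds (show (0 : ℝ) < 1 / 2 by norm_num)))
  refine ⟨min (ε / 2) 1, by positivity, min_le_right _ _, fun τ h0 h1 => ?_⟩
  have h2 : dist τ 0 < ε := by
    rw [Real.dist_eq, sub_zero, abs_of_nonneg h0]
    linarith [min_le_left (ε / 2) 1]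
  refine le_trans ?_ (hε' h2).le
  have : 0 ≤ τ ^ (1 - γ) / (1 - γ) := div_nonneg (Real.rpow_nonneg h0 _) (by linarith)
  exact mul_le_mul_of_nonneg_right (le_abs_self A) this

/-- Banach's fixed point theorem on the ball of radius 2Cr. The length δ depends on C, γ, L and Λ
only; in particular it is uniform in the nonlinearities satisfying the bounds. -/
theorem volterra_wellPosed [CompleteSpace X] {P : ℝ → X → X}
    (hP : BoundedPropagator P C) (hK : SingularKernel K C γ) {r : ℝ} (L Λ : ℝ)
    (hL : 0 ≤ L) (hΛ : 0 ≤ Λ) :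
    ∃ δ : ℝ, 0 < δ ∧ δ ≤ 1 ∧ ∀ a T : ℝ, a ≤ T → T ≤ a + δ → ∀ N : C(Icc a T, X) → ℝ → F,
      (∀ b, Continuous (N b)) → (∀ b s, ‖N b s‖ ≤ L * ‖b‖) →
      (∀ b b' s, ‖b‖ ≤ 2 * (C * r) → ‖b'‖ ≤ 2 * (C * r) → ‖N b s - N b' s‖ ≤ Λ * ‖b - b'‖) →
      (∀ Y, ‖Y‖ ≤ r → ∃! b, IsVolterraSolution P K N Y b) ∧
      (∀ Y Y' b b', ‖Y‖ ≤ r → ‖Y'‖ ≤ r → IsVolterraSolution P K N Y b →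
        IsVolterraSolution P K N Y' b' → ‖b - b'‖ ≤ 2 * C * ‖Y - Y'‖) := by
  have hC := hK.nonneg
  have hγ := hK.lt_one
  -- The sum L + Λ dominates both constants, so one δ serves the growth estimate and the contraction
  -- estimate.
  obtain ⟨δ, hδ, hδ1, hsmall⟩ := exists_small_pow hγ (C * (L + Λ))
  refine ⟨δ, hδ, hδ1, fun a T haT hT N hNc hNL hNΛ => ?_⟩
  have hpos : ∀ τ : ℝ, 0 ≤ τ → 0 ≤ τ ^ (1 - γ) / (1 - γ) := fun τ h =>
    div_nonneg (Real.rpow_nonneg h _) (by linarith)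
  have hint : ∀ (f : ℝ → F) (q x : ℝ), 0 ≤ x → q ≤ L + Λ → (∀ s, ‖f s‖ ≤ q * x) → ∀ t : Icc a T,
      ‖∫ s in a..t, K (t - s) (f s)‖ ≤ 1 / 2 * x := by
    intro f q x hx hq hf t
    have h1 : (0 : ℝ) ≤ t - a := by linarith [t.2.1]
    have h2 : (t : ℝ) - a ≤ δ := by linarith [t.2.2]
    refine (hK.norm_integral_le hf t.2.1 (by linarith)).trans ?_
    have h3 := hpos _ h1
    calc C * (q * x) * (((t : ℝ) - a) ^ (1 - γ) / (1 - γ))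
        = C * q * (((t : ℝ) - a) ^ (1 - γ) / (1 - γ)) * x := by ring
      _ ≤ C * (L + Λ) * (((t : ℝ) - a) ^ (1 - γ) / (1 - γ)) * x := by gcongr
      _ ≤ 1 / 2 * x := by gcongr; exact hsmall _ h1 h2
  have hmem : ∀ t : Icc a T, (t : ℝ) - a ∈ Icc (0 : ℝ) 1 := fun t =>
    ⟨by linarith [t.2.1], by linarith [t.2.2]⟩
  have hcont : ∀ Y b, Continuous fun t : Icc a T =>
      P (t - a) Y + ∫ s in a..t, K (t - s) (N b s) := by
    intro Y b
    refine Continuous.add ?_ ?_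
    · exact (hP.continuousOn Y).comp_continuous (by fun_prop) hmem
    · exact (hK.continuousOn_integral (hNc b) (hNL b) a).comp_continuous continuous_subtype_val
        fun t => ⟨t.2.1, by linarith [t.2.2]⟩
  let Φ : X → C(Icc a T, X) → C(Icc a T, X) := fun Y b => ⟨_, hcont Y b⟩
  have hΦ : ∀ Y b t, Φ Y b t = P ((t : ℝ) - a) Y + ∫ s in a..t, K (t - s) (N b s) :=
    fun _ _ _ => rfl
  have hΦnorm : ∀ Y b, ‖Y‖ ≤ r → ‖Φ Y b‖ ≤ C * r + 1 / 2 * ‖b‖ := by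
    intro Y b hY
    have hr : 0 ≤ r := (norm_nonneg _).trans hY
    refine (ContinuousMap.norm_le _ (by positivity)).2 fun t => ?_
    rw [hΦ]
    refine (norm_add_le _ _).trans (add_le_add ?_ ?_)
    · exact (hP.bound _ (hmem t) Y).trans (by gcongr)
    · exact hint _ L ‖b‖ (norm_nonneg _) (by linarith) (hNL b) t
  have hΦsub : ∀ Y Y' b b', ‖b‖ ≤ 2 * (C * r) → ‖b'‖ ≤ 2 * (C * r) →
      ‖Φ Y b - Φ Y' b'‖ ≤ C * ‖Y - Y'‖ + 1 / 2 * ‖b - b'‖ := by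
    intro Y Y' b b' hb hb'
    refine (ContinuousMap.norm_le _ (by positivity)).2 fun t => ?_
    have hi := hK.intervalIntegrable (hNc b) (hNL b) t.2.1 (by linarith [t.2.2])
    have hi' := hK.intervalIntegrable (hNc b') (hNL b') t.2.1 (by linarith [t.2.2])
    -- Additivity of K is unavailable at time 0. After the substitution this time is the excluded
    -- end of (0, t - a]; the pair-valued kernel lets the difference of the two integrands be
    -- substituted as one convolution.
    have hsub : ∫ s in a..t, K (t - s) (N b s - N b' s)
        = (∫ s in a..t, K (t - s) (N b s)) - ∫ s in a..t, K (t - s) (N b' s) := by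
      rw [← intervalIntegral.integral_sub hi hi',
        SingularKernel.integral_eq (K := K) (t : ℝ) a (fun s => N b s - N b' s),
        SingularKernel.integral_eq (K := fun σ (p : F × F) => K σ p.1 - K σ p.2) (t : ℝ) a
          (fun s => (N b s, N b' s))]
      refine intervalIntegral.integral_congr_ae (Eventually.of_forall fun σ hσ => ?_)
      rw [uIoc_of_le (hmem t).1] at hσ
      exact hK.map_sub σ ⟨hσ.1, hσ.2.trans (hmem t).2⟩ _ _
    have heq : (Φ Y b - Φ Y' b') t = P ((t : ℝ) - a) (Y - Y') +
        ∫ s in a..t, K (t - s) (N b s - N b' s) := by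
      rw [ContinuousMap.sub_apply, hΦ, hΦ, hP.map_sub _ (hmem t), hsub]
      abel
    rw [heq]
    refine (norm_add_le _ _).trans (add_le_add (hP.bound _ (hmem t) _) ?_)
    exact hint _ Λ _ (norm_nonneg _) (by linarith) (fun s => hNΛ b b' s hb hb') t
  have hfix : ∀ Y b, IsVolterraSolution P K N Y b → Φ Y b = b := fun Y b h =>
    ContinuousMap.ext fun t => (h t).symm
  -- The growth estimate does not presuppose that b lies in the ball; this turns uniqueness in the
  -- ball into uniqueness among all curves.
  have hapriori : ∀ Y b, ‖Y‖ ≤ r → IsVolterraSolution P K N Y b → ‖b‖ ≤ 2 * (C * r) := by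
    intro Y b hY h
    have := hΦnorm Y b hY
    rw [hfix Y b h] at this
    linarith
  have hLip : ∀ Y Y' b b', ‖Y‖ ≤ r → ‖Y'‖ ≤ r → IsVolterraSolution P K N Y b →
      IsVolterraSolution P K N Y' b' → ‖b - b'‖ ≤ 2 * C * ‖Y - Y'‖ := by
    intro Y Y' b b' hY hY' h h'
    have := hΦsub Y Y' b b' (hapriori Y b hY h) (hapriori Y' b' hY' h')
    rw [hfix Y b h, hfix Y' b' h'] at this
    linarith
  refine ⟨fun Y hY => ?_, hLip⟩
  have hr : 0 ≤ r := (norm_nonneg _).trans hY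
  have hmaps : MapsTo (Φ Y) (Metric.closedBall 0 (2 * (C * r))) (Metric.closedBall 0 (2 * (C * r))) := by
    intro b hb
    rw [mem_closedBall_zero_iff] at hb ⊢
    linarith [hΦnorm Y b hY]
  have hcontr : ContractingWith (1 / 2) (hmaps.restrict (Φ Y) _ _) := by
    refine ⟨by rw [← NNReal.coe_lt_coe]; norm_num, LipschitzWith.of_dist_le_mul fun b b' => ?_⟩
    have := hΦsub Y Y b b' (mem_closedBall_zero_iff.1 b.2) (mem_closedBall_zero_iff.1 b'.2)
    rw [Subtype.dist_eq, Subtype.dist_eq, dist_eq_norm, dist_eq_norm]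
    simpa using this
  obtain ⟨b, -, hb, -, -⟩ := hcontr.exists_fixedPoint' Metric.isClosed_closedBall.isComplete hmaps
    (x := 0) (Metric.mem_closedBall_self (by positivity)) (edist_ne_top _ _)
  have hsol : IsVolterraSolution P K N Y b := fun t => by
    rw [← hΦ]; exact (congrArg (fun c : C(Icc a T, X) => c t) hb).symm
  refine ⟨b, hsol, fun b' hb' => ?_⟩
  have := hLip Y Y b' b hY hY hb' hsol
  rw [sub_self, norm_zero, mul_zero] at this
  exact sub_eq_zero.1 (norm_le_zero_iff.1 this)

end Volterra

/-! ### The stable density: vertical contour shifts and decay at zero -/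

section StableDensity

/-- The Bochner integral of a non-integrable function is 0, whereas the Gamma formula gives a
positive value. -/
theorem integrableOn_rpow_mul_exp_neg_mul_rpow_Ioi {p q b : ℝ} (hp : 0 < p) (hq : -1 < q)
    (hb : 0 < b) : IntegrableOn (fun x : ℝ => x ^ q * Real.exp (-b * x ^ p)) (Ioi 0) := by
  refine Integrable.of_integral_ne_zero ?_
  rw [integral_rpow_mul_exp_neg_mul_rpow hp hq hb]
  have h1 : 0 < Real.Gamma ((q + 1) / p) := Real.Gamma_pos_of_pos (div_pos (by linarith) hp)
  positivity

theorem integrableOn_exp_neg_mul_rpow_Ioi {p b : ℝ} (hp : 0 < p) (hb : 0 < b) :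
    IntegrableOn (fun x : ℝ => Real.exp (-b * x ^ p)) (Ioi 0) := by
  simpa using integrableOn_rpow_mul_exp_neg_mul_rpow_Ioi (q := 0) hp (by norm_num) hb

/-- Since |arg s| ≤ π/2, the argument of s^β stays within ±πβ/2, where the cosine is bounded below.
This makes exp(-s^β) decay throughout the closed right half-plane. -/
theorem cos_mul_norm_rpow_le_re_cpow {β : ℝ} (hβ₀ : 0 < β) (hβ₁ : β < 1) {s : ℂ}
    (hs : 0 ≤ s.re) : Real.cos (Real.pi * β / 2) * ‖s‖ ^ β ≤ (s ^ (β : ℂ)).re := by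
  rcases eq_or_ne s 0 with rfl | h0
  · rw [norm_zero, Real.zero_rpow hβ₀.ne', Complex.zero_cpow (by exact_mod_cast hβ₀.ne')]
    simp
  have harg := Complex.abs_arg_le_pi_div_two_iff.2 hs
  have hcos : Real.cos (Real.pi * β / 2) ≤ Real.cos (β * s.arg) := by
    rw [← Real.cos_abs (β * s.arg)]
    refine Real.cos_le_cos_of_nonneg_of_le_pi (abs_nonneg _) (by nlinarith [Real.pi_pos]) ?_
    rw [abs_mul, abs_of_pos hβ₀]
    nlinarith
  have hre : (s ^ (β : ℂ)).re = ‖s‖ ^ β * Real.cos (β * s.arg) := by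
    rw [Complex.cpow_def_of_ne_zero h0, Complex.exp_re, Real.rpow_def_of_pos (norm_pos_iff.2 h0)]
    simp [Complex.log_re, Complex.log_im, mul_comm]
  rw [hre, mul_comm]
  gcongr

theorem cos_pi_mul_div_two_pos {β : ℝ} (hβ₀ : 0 < β) (hβ₁ : β < 1) :
    0 < Real.cos (Real.pi * β / 2) :=
  Real.cos_pos_of_mem_Ioo ⟨by nlinarith [Real.pi_pos], by nlinarith [Real.pi_pos]⟩

/-- The integrand `exp (s y - s ^ β)` of the Bromwich integral of the stable density. -/
noncomputable def bromwichIntegrand (β y : ℝ) (s : ℂ) : ℂ := Complex.exp (s * y - s ^ (β : ℂ))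

theorem norm_bromwichIntegrand_le {β : ℝ} (hβ₀ : 0 < β) (hβ₁ : β < 1) (y : ℝ) {s : ℂ}
    (hs : 0 ≤ s.re) : ‖bromwichIntegrand β y s‖ ≤
      Real.exp (s.re * y - Real.cos (Real.pi * β / 2) * ‖s‖ ^ β) := by
  rw [bromwichIntegrand, Complex.norm_exp]
  have := cos_mul_norm_rpow_le_re_cpow hβ₀ hβ₁ hs
  refine Real.exp_le_exp.2 ?_
  simp only [Complex.sub_re, Complex.re_mul_ofReal]
  linarith

theorem continuousOn_bromwichIntegrand {β : ℝ} (hβ₀ : 0 < β) (y : ℝ) :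
    ContinuousOn (bromwichIntegrand β y) {s | 0 ≤ s.re} := by
  intro s hs
  have h1 : ContinuousAt (fun s : ℂ => s ^ (β : ℂ)) s :=
    Complex.continuousAt_cpow_const_of_re_pos (Or.inl hs) (by simpa using hβ₀)
  unfold bromwichIntegrand
  exact (((continuousAt_id.mul continuousAt_const).sub h1).cexp).continuousWithinAt

theorem differentiableAt_bromwichIntegrand {β : ℝ} (y : ℝ) {s : ℂ} (hs : 0 < s.re) :
    DifferentiableAt ℂ (bromwichIntegrand β y) s := by
  have h1 : DifferentiableAt ℂ (fun s : ℂ => s ^ (β : ℂ)) s :=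
    DifferentiableAt.cpow_const differentiableAt_id (Or.inl hs)
  unfold bromwichIntegrand
  exact ((differentiableAt_id.mul_const _).sub h1).cexp

theorem bromwichIntegrand_mul_I {β τ : ℝ} (y : ℝ) (hτ : 0 < τ) :
    bromwichIntegrand β y (τ * Complex.I) = Complex.exp (Complex.I * τ * y -
    (1 : ℝ) * ((τ ^ β : ℝ) : ℂ) * Complex.exp (Complex.I * Real.pi * β / 2)) := by
  have h1 : (τ * Complex.I : ℂ) ^ (β : ℂ) =
      ((τ ^ β : ℝ) : ℂ) * Complex.exp (Complex.I * Real.pi * β / 2) := by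
    rw [Complex.cpow_def_of_ne_zero (mul_ne_zero (by exact_mod_cast hτ.ne') Complex.I_ne_zero),
      Complex.log_ofReal_mul hτ Complex.I_ne_zero, Complex.log_I, add_mul, Complex.exp_add,
      Real.rpow_def_of_pos hτ]
    push_cast
    congr 2
    ring
  rw [bromwichIntegrand, h1]
  congr 1
  push_cast
  ring

/-- From |s|^β ≥ (σ^β + τ^β)/2. One half is integrable in τ, and the other keeps the gain
exp(-cσ^β). -/
theorem norm_bromwichIntegrand_line_le {β : ℝ} (hβ₀ : 0 < β) (hβ₁ : β < 1) (y : ℝ) {σ τ : ℝ}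
    (hσ : 0 ≤ σ) (hτ : 0 ≤ τ) : ‖bromwichIntegrand β y (σ + τ * Complex.I)‖ ≤
      Real.exp (σ * y - Real.cos (Real.pi * β / 2) / 2 * σ ^ β) *
        Real.exp (-(Real.cos (Real.pi * β / 2) / 2) * τ ^ β) := by
  have hc := cos_pi_mul_div_two_pos hβ₀ hβ₁
  have hre : (σ + τ * Complex.I : ℂ).re = σ := by simp
  have him : (σ + τ * Complex.I : ℂ).im = τ := by simp
  refine (norm_bromwichIntegrand_le hβ₀ hβ₁ y (by rw [hre]; exact hσ)).trans ?_
  rw [← Real.exp_add, hre]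
  refine Real.exp_le_exp.2 ?_
  have h1 : σ ^ β ≤ ‖(σ + τ * Complex.I : ℂ)‖ ^ β := by
    refine Real.rpow_le_rpow hσ ?_ hβ₀.le
    have := Complex.abs_re_le_norm (σ + τ * Complex.I : ℂ)
    rwa [hre, abs_of_nonneg hσ] at this
  have h2 : τ ^ β ≤ ‖(σ + τ * Complex.I : ℂ)‖ ^ β := by
    refine Real.rpow_le_rpow hτ ?_ hβ₀.le
    have := Complex.abs_im_le_norm (σ + τ * Complex.I : ℂ)
    rwa [him, abs_of_nonneg hτ] at this
  nlinarith

theorem continuousOn_bromwichIntegrand_line {β : ℝ} (hβ₀ : 0 < β) (y : ℝ) {σ : ℝ} (hσ : 0 ≤ σ) :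
    Continuous fun τ : ℝ => bromwichIntegrand β y (σ + τ * Complex.I) :=
  (continuousOn_bromwichIntegrand hβ₀ y).comp_continuous (by fun_prop) fun τ => by simpa using hσ

theorem integrableOn_bromwichIntegrand_line {β : ℝ} (hβ₀ : 0 < β) (hβ₁ : β < 1) (y : ℝ) {σ : ℝ}
    (hσ : 0 ≤ σ) :
    IntegrableOn (fun τ : ℝ => bromwichIntegrand β y (σ + τ * Complex.I)) (Ioi 0) := by
  have hc := cos_pi_mul_div_two_pos hβ₀ hβ₁
  refine Integrable.mono' ((integrableOn_exp_neg_mul_rpow_Ioi hβ₀ (half_pos hc)).const_mul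
    (Real.exp (σ * y - Real.cos (Real.pi * β / 2) / 2 * σ ^ β)))
    (continuousOn_bromwichIntegrand_line hβ₀ y hσ).aestronglyMeasurable ?_
  filter_upwards [ae_restrict_mem measurableSet_Ioi] with τ hτ
  exact norm_bromwichIntegrand_line_le hβ₀ hβ₁ y hσ (le_of_lt hτ)

theorem bromwichIntegrand_ofReal_im {β : ℝ} (y : ℝ) {x : ℝ} (hx : 0 ≤ x) :
    (bromwichIntegrand β y x).im = 0 := by
  have : bromwichIntegrand β y x = ((Real.exp (x * y - x ^ β) : ℝ) : ℂ) := by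
    rw [bromwichIntegrand, Complex.ofReal_exp]
    push_cast [Complex.ofReal_cpow hx]
    rfl
  rw [this, Complex.ofReal_im]

/-- The real part of the half-line integrals does not depend on the abscissa. -/
theorem re_integral_bromwichIntegrand_shift {β : ℝ} (hβ₀ : 0 < β) (hβ₁ : β < 1) (y : ℝ) {σ : ℝ}
    (hσ : 0 ≤ σ) :
    (∫ τ in Ioi (0 : ℝ), bromwichIntegrand β y (σ + τ * Complex.I)).re =
      (∫ τ in Ioi (0 : ℝ), bromwichIntegrand β y (τ * Complex.I)).re := by
  have hc := cos_pi_mul_div_two_pos hβ₀ hβ₁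
  set φ := bromwichIntegrand β y with hφ
  -- Imaginary part of Cauchy's theorem on the rectangle with corners 0 and σ + iR. The bottom side
  -- drops out because the integrand is real on the real axis.
  have hrect : ∀ R : ℝ, 0 < R → (∫ τ in (0 : ℝ)..R, φ (σ + τ * Complex.I)).re -
      (∫ τ in (0 : ℝ)..R, φ (τ * Complex.I)).re = (∫ x in (0 : ℝ)..σ, φ (x + R * Complex.I)).im := by
    intro R hR
    have h := Complex.integral_boundary_rect_eq_zero_of_continuousOn_of_differentiableOn φ 0
      (σ + R * Complex.I) ?_ ?_
    · have him : (∫ x in (0 : ℝ)..σ, φ x).im = 0 := by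
        have hi : IntervalIntegrable (fun x : ℝ => φ x) volume 0 σ := by
          refine ContinuousOn.intervalIntegrable ?_
          refine (continuousOn_bromwichIntegrand hβ₀ y).comp (by fun_prop) fun x hx => ?_
          rw [uIcc_of_le hσ] at hx
          simpa using hx.1
        have := Complex.imCLM.intervalIntegral_comp_comm hi
        simp only [Complex.imCLM_apply] at this
        rw [← this]
        refine intervalIntegral.integral_zero_ae (Eventually.of_forall fun x hx => ?_)
        rw [uIoc_of_le hσ] at hx
        exact bromwichIntegrand_ofReal_im y hx.1.le
      have h' := congrArg Complex.im h
      simp at h'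
      rw [him] at h'
      linarith
    · refine (continuousOn_bromwichIntegrand hβ₀ y).mono fun s hs => ?_
      have := hs.1
      simp [uIcc_of_le hσ] at this
      exact this.1
    · intro s hs
      have := hs.1
      simp [min_eq_left hσ] at this
      exact (differentiableAt_bromwichIntegrand y this.1).differentiableWithinAt
  have hi0 : IntegrableOn (fun τ : ℝ => φ (τ * Complex.I)) (Ioi 0) := by
    simpa using integrableOn_bromwichIntegrand_line hβ₀ hβ₁ y le_rfl
  have l1 := (Complex.continuous_re.tendsto _).comp (intervalIntegral_tendsto_integral_Ioi 0
    (integrableOn_bromwichIntegrand_line hβ₀ hβ₁ y hσ) tendsto_id)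
  have l2 := (Complex.continuous_re.tendsto _).comp
    (intervalIntegral_tendsto_integral_Ioi 0 hi0 tendsto_id)
  have l3 : Tendsto (fun R : ℝ => (∫ x in (0 : ℝ)..σ, φ (x + R * Complex.I)).im) atTop (𝓝 0) := by
    have hb : Tendsto (fun R : ℝ => Real.exp (σ * |y|) *
        Real.exp (-(Real.cos (Real.pi * β / 2) / 2 * R ^ β)) * |σ - 0|) atTop (𝓝 0) := by
      have : Tendsto (fun R : ℝ => Real.cos (Real.pi * β / 2) / 2 * R ^ β) atTop atTop :=
        (tendsto_rpow_atTop hβ₀).const_mul_atTop (half_pos hc)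
      simpa using ((Real.tendsto_exp_neg_atTop_nhds_zero.comp this).const_mul
        (Real.exp (σ * |y|))).mul_const |σ - 0|
    refine squeeze_zero_norm' ?_ hb
    filter_upwards [eventually_gt_atTop 0] with R hR
    refine (Complex.abs_im_le_norm _).trans
      (intervalIntegral.norm_integral_le_of_norm_le_const fun x hx => ?_)
    rw [uIoc_of_le hσ] at hx
    refine (norm_bromwichIntegrand_line_le hβ₀ hβ₁ y hx.1.le hR.le).trans ?_
    rw [neg_mul]
    gcongr
    have e1 : x * y ≤ σ * |y| := (mul_le_mul_of_nonneg_left (le_abs_self y) hx.1.le).trans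
      (mul_le_mul_of_nonneg_right hx.2 (abs_nonneg y))
    have e2 : 0 ≤ Real.cos (Real.pi * β / 2) / 2 * x ^ β :=
      mul_nonneg (half_pos hc).le (Real.rpow_nonneg hx.1.le _)
    linarith
  have l4 := l1.sub l2
  have heq : (fun R : ℝ => (∫ τ in (0 : ℝ)..R, φ (σ + τ * Complex.I)).re -
      (∫ τ in (0 : ℝ)..R, φ (τ * Complex.I)).re) =ᶠ[atTop]
      fun R : ℝ => (∫ x in (0 : ℝ)..σ, φ (x + R * Complex.I)).im := by
    filter_upwards [eventually_gt_atTop 0] with R hR using hrect R hR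
  exact sub_eq_zero.1 (tendsto_nhds_unique l4 (l3.congr' heq.symm))

theorem stableDensity_eq (β y : ℝ) : stableDensity β 1 y =
    1 / Real.pi * (∫ τ in Ioi (0 : ℝ), bromwichIntegrand β y (τ * Complex.I)).re := by
  rw [stableDensity]
  congr 2
  refine setIntegral_congr_fun measurableSet_Ioi fun τ hτ => ?_
  rw [bromwichIntegrand_mul_I y hτ]

/-- The abscissa σ stays free, to be chosen according to y: σ → ∞ kills the density for y < 0, and σ
proportional to 1/y gives the decay as y → 0+. -/
theorem exists_abs_stableDensity_le {β : ℝ} (hβ₀ : 0 < β) (hβ₁ : β < 1) :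
    ∃ J c : ℝ, 0 ≤ J ∧ 0 < c ∧ ∀ y σ : ℝ, 0 ≤ σ →
      |stableDensity β 1 y| ≤ J * Real.exp (σ * y - c * σ ^ β) := by
  have hc := half_pos (cos_pi_mul_div_two_pos hβ₀ hβ₁)
  have hbd := fun (y σ τ : ℝ) => norm_bromwichIntegrand_line_le (σ := σ) (τ := τ) hβ₀ hβ₁ y
  generalize Real.cos (Real.pi * β / 2) / 2 = c at hc hbd
  refine ⟨1 / Real.pi * ∫ τ in Ioi (0 : ℝ), Real.exp (-c * τ ^ β), c, ?_, hc, fun y σ hσ => ?_⟩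
  · exact mul_nonneg (one_div_nonneg.2 Real.pi_pos.le) (integral_nonneg fun _ => (Real.exp_pos _).le)
  rw [stableDensity_eq, ← re_integral_bromwichIntegrand_shift hβ₀ hβ₁ y hσ, abs_mul,
    abs_of_nonneg (one_div_nonneg.2 Real.pi_pos.le), mul_assoc]
  refine mul_le_mul_of_nonneg_left ?_ (one_div_nonneg.2 Real.pi_pos.le)
  refine (Complex.abs_re_le_norm _).trans ?_
  rw [← integral_mul_const]
  refine norm_integral_le_of_norm_le
    ((integrableOn_exp_neg_mul_rpow_Ioi hβ₀ hc).mul_const _) ?_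
  filter_upwards [ae_restrict_mem measurableSet_Ioi] with τ hτ
  exact (hbd y σ τ hσ (le_of_lt hτ)).trans_eq (mul_comm _ _)

theorem stableDensity_of_neg {β : ℝ} (hβ₀ : 0 < β) (hβ₁ : β < 1) {y : ℝ} (hy : y < 0) :
    stableDensity β 1 y = 0 := by
  obtain ⟨J, c, hJ, hc, h⟩ := exists_abs_stableDensity_le hβ₀ hβ₁
  have hlim : Tendsto (fun σ : ℝ => J * Real.exp (-(-y * σ))) atTop (𝓝 0) := by
    have : Tendsto (fun σ : ℝ => -y * σ) atTop atTop :=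
      tendsto_id.const_mul_atTop (by linarith)
    simpa using (Real.tendsto_exp_neg_atTop_nhds_zero.comp this).const_mul J
  refine abs_nonpos_iff.1 (ge_of_tendsto hlim ?_)
  filter_upwards [eventually_ge_atTop 0] with σ hσ
  refine (h y σ hσ).trans ?_
  gcongr
  have := mul_nonneg hc.le (Real.rpow_nonneg hσ β)
  linarith

theorem exists_abs_stableDensity_le_exp {β : ℝ} (hβ₀ : 0 < β) (hβ₁ : β < 1) {μ : ℝ} (hμ : 0 < μ) :
    ∃ C : ℝ, 0 ≤ C ∧ ∀ y, 0 < y → |stableDensity β 1 y| ≤ C * Real.exp (-μ * y ^ (-β)) := by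
  obtain ⟨J, c, hJ, hc, h⟩ := exists_abs_stableDensity_le hβ₀ hβ₁
  have hk : 0 < (μ / c) ^ (1 / β) := Real.rpow_pos_of_pos (by positivity) _
  refine ⟨J * Real.exp ((μ / c) ^ (1 / β)), by positivity, fun y hy => ?_⟩
  -- With this σ the product σy is constant in y, while cσ^β = μ y^(-β).
  refine (h y ((μ / c) ^ (1 / β) / y) (by positivity)).trans (le_of_eq ?_)
  rw [mul_assoc, ← Real.exp_add, Real.div_rpow hk.le hy.le, ← Real.rpow_mul (by positivity),
    one_div_mul_cancel hβ₀.ne', Real.rpow_one, div_mul_cancel₀ _ hy.ne', Real.rpow_neg hy.le]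
  congr 2
  field_simp
  ring

theorem continuous_stableDensity {β : ℝ} (hβ₀ : 0 < β) (hβ₁ : β < 1) :
    Continuous (stableDensity β 1) := by
  have hc := cos_pi_mul_div_two_pos hβ₀ hβ₁
  have h1 : Continuous fun y : ℝ => ∫ τ in Ioi (0 : ℝ), bromwichIntegrand β y (τ * Complex.I) := by
    refine continuous_of_dominated (fun y => ?_) (bound := fun τ =>
      Real.exp (-(Real.cos (Real.pi * β / 2) / 2) * τ ^ β)) (fun y => ?_) ?_ ?_
    · simpa using (continuousOn_bromwichIntegrand_line hβ₀ y le_rfl).aestronglyMeasurable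
    · filter_upwards [ae_restrict_mem measurableSet_Ioi] with τ hτ
      simpa [Real.zero_rpow hβ₀.ne'] using
        norm_bromwichIntegrand_line_le hβ₀ hβ₁ y le_rfl (le_of_lt hτ)
    · exact integrableOn_exp_neg_mul_rpow_Ioi hβ₀ (half_pos hc)
    · refine Eventually.of_forall fun τ => ?_
      unfold bromwichIntegrand
      fun_prop
  have h2 : stableDensity β 1 = fun y => 1 / Real.pi *
      (∫ τ in Ioi (0 : ℝ), bromwichIntegrand β y (τ * Complex.I)).re :=
    funext fun y => stableDensity_eq β y
  rw [h2]
  exact continuous_const.mul (Complex.continuous_re.comp h1)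

end StableDensity

/-! ### The power tail of the stable density, by rotation of the contour -/

section StableDensityTail

/-- The integrand `exp (s y - s ^ β)`, times `ds / dq`, along the ray `s = q e^{iψ}`. -/
noncomputable def rayIntegrand (β y ψ q : ℝ) : ℂ :=
  Complex.exp (ψ * Complex.I) * Complex.exp (q * y * Complex.exp (ψ * Complex.I) -
    ((q ^ β : ℝ) : ℂ) * Complex.exp (β * ψ * Complex.I))

theorem norm_rayIntegrand_le {β y ψ c q : ℝ} (hq : 0 ≤ q) (hy : 0 ≤ y)
    (hψ : Real.cos ψ ≤ 0) (hc : c ≤ Real.cos (β * ψ)) :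
    ‖rayIntegrand β y ψ q‖ ≤ Real.exp (-c * q ^ β) := by
  have h1 : (Complex.exp (ψ * Complex.I)).re = Real.cos ψ := Complex.exp_ofReal_mul_I_re ψ
  have h2 : (Complex.exp (β * ψ * Complex.I)).re = Real.cos (β * ψ) := by
    rw [← Complex.exp_ofReal_mul_I_re]; push_cast; rfl
  have h3 : (q * y * Complex.exp (ψ * Complex.I) -
    ((q ^ β : ℝ) : ℂ) * Complex.exp (β * ψ * Complex.I)).re =
      q * y * Real.cos ψ - q ^ β * Real.cos (β * ψ) := by
    rw [← Complex.ofReal_mul, Complex.sub_re, Complex.re_ofReal_mul, Complex.re_ofReal_mul, h1, h2]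
  rw [rayIntegrand, norm_mul, Complex.norm_exp_ofReal_mul_I, one_mul, Complex.norm_exp, h3]
  refine Real.exp_le_exp.2 ?_
  have h4 : q * y * Real.cos ψ ≤ 0 := mul_nonpos_of_nonneg_of_nonpos (by positivity) hψ
  have h5 := mul_le_mul_of_nonneg_left hc (Real.rpow_nonneg hq β)
  linarith

theorem continuous_rayIntegrand {β : ℝ} (hβ₀ : 0 < β) (y ψ : ℝ) :
    Continuous (rayIntegrand β y ψ) := by
  have : Continuous fun q : ℝ => q ^ β := Real.continuous_rpow_const hβ₀.le
  unfold rayIntegrand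
  fun_prop

theorem integrableOn_rayIntegrand {β y ψ : ℝ} (hβ₀ : 0 < β) (hy : 0 ≤ y)
    (hψ : Real.cos ψ ≤ 0) (hc : 0 < Real.cos (β * ψ)) :
    IntegrableOn (rayIntegrand β y ψ) (Ioi 0) := by
  refine Integrable.mono' (integrableOn_exp_neg_mul_rpow_Ioi hβ₀ hc)
    (continuous_rayIntegrand hβ₀ y ψ).aestronglyMeasurable ?_
  filter_upwards [ae_restrict_mem measurableSet_Ioi] with q hq
  exact norm_rayIntegrand_le (le_of_lt hq) hy hψ le_rfl

/-- The integrand in the logarithmic coordinate `w = log s`. -/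
noncomputable def logIntegrand (β y : ℝ) (w : ℂ) : ℂ :=
  Complex.exp (w + y * Complex.exp w - Complex.exp (β * w))

theorem logIntegrand_eq (β y ψ u : ℝ) : logIntegrand β y (u + ψ * Complex.I) =
    Real.exp u • rayIntegrand β y ψ (Real.exp u) := by
  rw [logIntegrand, rayIntegrand, Complex.real_smul, Complex.ofReal_exp, ← Complex.exp_add,
    ← Complex.exp_add, ← Real.exp_mul, Complex.ofReal_exp, mul_add (β : ℂ), Complex.exp_add (β * u),
    Complex.exp_add u]
  congr 1
  push_cast
  rw [mul_comm (u : ℂ) β, mul_assoc (β : ℂ)]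
  ring

theorem tendsto_intervalIntegral_exp {f : ℝ → ℂ} (hf : Continuous f)
    (hi : IntegrableOn f (Ioi 0)) :
    Tendsto (fun R : ℝ => ∫ u in (-R)..R, Real.exp u • f (Real.exp u)) atTop
      (𝓝 (∫ q in Ioi (0 : ℝ), f q)) := by
  have h1 : ∀ R : ℝ, ∫ u in (-R)..R, Real.exp u • f (Real.exp u) =
      (∫ q in (0 : ℝ)..Real.exp R, f q) - ∫ q in (0 : ℝ)..Real.exp (-R), f q := by
    intro R
    rw [intervalIntegral.integral_interval_sub_left (hf.intervalIntegrable _ _)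
      (hf.intervalIntegrable _ _)]
    exact intervalIntegral.integral_deriv_smul_comp (fun x _ => Real.hasDerivAt_exp x)
      Real.continuous_exp.continuousOn hf
  simp_rw [h1]
  have h2 := intervalIntegral_tendsto_integral_Ioi 0 hi Real.tendsto_exp_atTop
  have h3 : Tendsto (fun R : ℝ => ∫ q in (0 : ℝ)..Real.exp (-R), f q) atTop (𝓝 0) := by
    have hc : Continuous fun x : ℝ => ∫ q in (0 : ℝ)..x, f q :=
      intervalIntegral.continuous_primitive (fun a b => hf.intervalIntegrable a b) 0
    have := (hc.tendsto 0).comp Real.tendsto_exp_neg_atTop_nhds_zero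
    rwa [intervalIntegral.integral_same] at this
  simpa using h2.sub h3

/-- In the coordinate w = log s the rays become horizontal lines and the integrand entire, so
Cauchy's theorem on rectangles applies. The vertical sides are of size e^u exp(-c e^(βu)), which
vanishes at both ends: by the second factor as u → ∞, by the first as u → -∞. -/
theorem integral_rayIntegrand_eq {β y ψ₀ ψ₁ : ℝ} (hβ₀ : 0 < β) (hy : 0 ≤ y)
    (h01 : ψ₀ ≤ ψ₁) (hψ : ∀ ψ ∈ Icc ψ₀ ψ₁, Real.cos ψ ≤ 0) {c : ℝ} (hc : 0 < c)
    (hψc : ∀ ψ ∈ Icc ψ₀ ψ₁, c ≤ Real.cos (β * ψ)) :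
    ∫ q in Ioi (0 : ℝ), rayIntegrand β y ψ₀ q = ∫ q in Ioi (0 : ℝ), rayIntegrand β y ψ₁ q := by
  have hm0 : ψ₀ ∈ Icc ψ₀ ψ₁ := left_mem_Icc.2 h01
  have hm1 : ψ₁ ∈ Icc ψ₀ ψ₁ := right_mem_Icc.2 h01
  have hlim : ∀ ψ ∈ Icc ψ₀ ψ₁, Tendsto (fun R : ℝ => ∫ u in (-R)..R,
      logIntegrand β y (u + ψ * Complex.I)) atTop
      (𝓝 (∫ q in Ioi (0 : ℝ), rayIntegrand β y ψ q)) := by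
    intro ψ hm
    simp_rw [logIntegrand_eq]
    exact tendsto_intervalIntegral_exp (continuous_rayIntegrand hβ₀ y ψ)
      (integrableOn_rayIntegrand hβ₀ hy (hψ ψ hm) (hc.trans_le (hψc ψ hm)))
  have hside : ∀ u : ℝ, ‖∫ ψ in ψ₀..ψ₁, logIntegrand β y (u + ψ * Complex.I)‖ ≤
      Real.exp u * Real.exp (-c * Real.exp u ^ β) * |ψ₁ - ψ₀| := by
    intro u
    refine intervalIntegral.norm_integral_le_of_norm_le_const fun ψ hm => ?_
    rw [uIoc_of_le h01] at hm
    have hm' := Ioc_subset_Icc_self hm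
    rw [logIntegrand_eq, norm_smul, Real.norm_of_nonneg (Real.exp_pos u).le]
    gcongr
    exact norm_rayIntegrand_le (Real.exp_pos u).le hy (hψ ψ hm') (hψc ψ hm')
  have hright : Tendsto (fun R : ℝ => ∫ ψ in ψ₀..ψ₁, logIntegrand β y (R + ψ * Complex.I)) atTop
      (𝓝 0) := by
    refine squeeze_zero_norm hside ?_
    have h1 : Tendsto (fun x : ℝ => x ^ (1 / β) * Real.exp (-c * x)) atTop (𝓝 0) :=
      tendsto_rpow_mul_exp_neg_mul_atTop_nhds_zero _ _ hc
    have h2 : Tendsto (fun R : ℝ => Real.exp R ^ β) atTop atTop :=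
      (tendsto_rpow_atTop hβ₀).comp Real.tendsto_exp_atTop
    have h3 := (h1.comp h2).mul_const |ψ₁ - ψ₀|
    rw [zero_mul] at h3
    refine h3.congr fun R => ?_
    simp only [Function.comp]
    rw [← Real.rpow_mul (Real.exp_pos R).le, mul_one_div_cancel hβ₀.ne', Real.rpow_one]
  have hleft : Tendsto (fun R : ℝ => ∫ ψ in ψ₀..ψ₁,
      logIntegrand β y (((-R : ℝ) : ℂ) + ψ * Complex.I)) atTop (𝓝 0) := by
    have h1 := Real.tendsto_exp_neg_atTop_nhds_zero.mul_const |ψ₁ - ψ₀|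
    rw [zero_mul] at h1
    refine squeeze_zero_norm (fun R => (hside (-R)).trans ?_) h1
    have : Real.exp (-c * Real.exp (-R) ^ β) ≤ 1 := Real.exp_le_one_iff.2 (by
      have := mul_nonneg hc.le (Real.rpow_nonneg (Real.exp_pos (-R)).le β)
      linarith)
    have h2 := mul_le_mul_of_nonneg_left this (Real.exp_pos (-R)).le
    rw [mul_one] at h2
    exact mul_le_mul_of_nonneg_right h2 (abs_nonneg _)
  have hrect : ∀ R : ℝ, (∫ u in (-R)..R, logIntegrand β y (u + ψ₀ * Complex.I)) -
      (∫ u in (-R)..R, logIntegrand β y (u + ψ₁ * Complex.I)) +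
      Complex.I * (∫ ψ in ψ₀..ψ₁, logIntegrand β y (R + ψ * Complex.I)) -
      Complex.I * (∫ ψ in ψ₀..ψ₁, logIntegrand β y (((-R : ℝ) : ℂ) + ψ * Complex.I)) = 0 := by
    intro R
    have hd : Differentiable ℂ (logIntegrand β y) := by unfold logIntegrand; fun_prop
    have h := Complex.integral_boundary_rect_eq_zero_of_differentiableOn (logIntegrand β y)
      (((-R : ℝ) : ℂ) + ψ₀ * Complex.I) ((R : ℂ) + ψ₁ * Complex.I) hd.differentiableOn
    simpa using h
  have htot := (((hlim ψ₀ hm0).sub (hlim ψ₁ hm1)).add (hright.const_mul Complex.I)).sub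
    (hleft.const_mul Complex.I)
  have h0 := tendsto_nhds_unique htot (tendsto_const_nhds.congr fun R => (hrect R).symm)
  simpa [sub_eq_zero] using h0

theorem norm_exp_neg_sub_one_le {z : ℂ} (hz : 0 ≤ z.re) : ‖Complex.exp (-z) - 1‖ ≤ 2 * ‖z‖ := by
  rcases le_total ‖z‖ 1 with h | h
  · simpa using Complex.norm_exp_sub_one_le (x := -z) (by simpa using h)
  · have h1 : ‖Complex.exp (-z)‖ ≤ 1 := by
      rw [Complex.norm_exp]; exact Real.exp_le_one_iff.2 (by simpa using hz)
    calc _ ≤ ‖Complex.exp (-z)‖ + ‖(1 : ℂ)‖ := norm_sub_le _ _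
      _ ≤ 2 * ‖z‖ := by rw [norm_one]; linarith

theorem stableDensity_eq_ray (β y : ℝ) : stableDensity β 1 y =
    1 / Real.pi * (∫ q in Ioi (0 : ℝ), rayIntegrand β y (Real.pi / 2) q).im := by
  have h : ∀ q ∈ Ioi (0 : ℝ), rayIntegrand β y (Real.pi / 2) q =
      Complex.I * bromwichIntegrand β y (q * Complex.I) := by
    intro q hq
    rw [bromwichIntegrand_mul_I y hq, rayIntegrand]
    push_cast
    rw [Complex.exp_pi_div_two_mul_I]
    congr 2
    rw [show (β : ℂ) * (Real.pi / 2) * Complex.I = Complex.I * Real.pi * β / 2 by ring]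
    ring
  rw [stableDensity_eq, setIntegral_congr_fun measurableSet_Ioi h, integral_const_mul]
  simp

/-- The power tail of the stable density. -/
theorem exists_abs_stableDensity_le_rpow {β : ℝ} (hβ₀ : 0 < β) (hβ₁ : β < 1) :
    ∃ C : ℝ, 0 ≤ C ∧ ∀ y, 0 < y → |stableDensity β 1 y| ≤ C * y ^ (-(1 + β)) := by
  have hπ := Real.pi_pos
  -- An angle with ψ > π/2 and βψ = π - ψ < π/2, so that both exp(sy) and exp(-s^β) decay along the
  -- ray.
  set ψ := Real.pi / (1 + β) with hψdef
  have h1 : Real.pi / 2 < ψ := by rw [hψdef]; gcongr; linarith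
  have h2 : ψ < Real.pi := by rw [hψdef]; exact div_lt_self hπ (by linarith)
  have h3 : β * ψ < Real.pi / 2 := by
    have : ψ * (1 + β) = Real.pi := div_mul_cancel₀ _ (by linarith)
    linarith
  have h4 : 0 < Real.cos (β * ψ) := Real.cos_pos_of_mem_Ioo ⟨by nlinarith, h3⟩
  have h5 : 0 < -Real.cos ψ := by
    have := Real.cos_neg_of_pi_div_two_lt_of_lt h1 (by linarith); linarith
  set ρ := -Real.cos ψ with hρ
  refine ⟨1 / Real.pi * (2 * (1 / ρ) ^ (1 + β) * Real.Gamma (1 + β)), ?_, fun y hy => ?_⟩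
  · have := Real.Gamma_pos_of_pos (show 0 < 1 + β by linarith)
    positivity
  have hray : ∫ q in Ioi (0 : ℝ), rayIntegrand β y (Real.pi / 2) q =
      ∫ q in Ioi (0 : ℝ), rayIntegrand β y ψ q := by
    refine integral_rayIntegrand_eq hβ₀ hy.le h1.le (fun ψ' h => ?_) h4 (fun ψ' h => ?_)
    · exact Real.cos_nonpos_of_pi_div_two_le_of_le h.1 (by linarith [h.2])
    · exact Real.cos_le_cos_of_nonneg_of_le_pi (by nlinarith [h.1]) (by linarith) (by
        nlinarith [h.2])
  set E := Complex.exp (ψ * Complex.I) with hE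
  have hEre : (y * E).re = -(ρ * y) := by
    rw [Complex.re_ofReal_mul, hE, Complex.exp_ofReal_mul_I_re, hρ]; ring
  have hneg : (y * E).re < 0 := by rw [hEre]; nlinarith
  have hE0 : E ≠ 0 := Complex.exp_ne_zero _
  have hi1 : IntegrableOn (fun q : ℝ => E * Complex.exp (y * E * q)) (Ioi 0) :=
    (integrableOn_exp_mul_complex_Ioi hneg 0).const_mul E
  -- The integral without the factor exp(-s^β) is the real number -1/y, so subtracting it leaves the
  -- imaginary part unchanged. It replaces exp(-z) by exp(-z) - 1 = O(q^β), which gains the factor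
  -- y^(-β).
  have hint1 : (∫ q in Ioi (0 : ℝ), E * Complex.exp (y * E * q)).im = 0 := by
    rw [integral_const_mul, integral_exp_mul_complex_Ioi hneg 0]
    have : E * (-Complex.exp (y * E * (0 : ℝ)) / (y * E)) = ((-(1 / y) : ℝ) : ℂ) := by
      have : (y : ℂ) ≠ 0 := by exact_mod_cast hy.ne'
      push_cast
      rw [mul_zero, Complex.exp_zero]
      field_simp
    rw [this, Complex.ofReal_im]
  have hG : stableDensity β 1 y = 1 / Real.pi *
      (∫ q in Ioi (0 : ℝ), (rayIntegrand β y ψ q - E * Complex.exp (y * E * q))).im := by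
    rw [integral_sub (integrableOn_rayIntegrand hβ₀ hy.le (by linarith) h4) hi1, Complex.sub_im,
      hint1, sub_zero, stableDensity_eq_ray, hray]
  have hgam := Real.integral_rpow_mul_exp_neg_mul_Ioi (show 0 < 1 + β by linarith)
    (show 0 < ρ * y by positivity)
  have hgi : IntegrableOn (fun t : ℝ => t ^ (1 + β - 1) * Real.exp (-(ρ * y * t))) (Ioi 0) := by
    refine Integrable.of_integral_ne_zero ?_
    rw [hgam]
    have := Real.Gamma_pos_of_pos (show 0 < 1 + β by linarith)
    positivity
  have hfin : ‖∫ q in Ioi (0 : ℝ), (rayIntegrand β y ψ q - E * Complex.exp (y * E * q))‖ ≤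
      2 * ((1 / (ρ * y)) ^ (1 + β) * Real.Gamma (1 + β)) := by
    rw [← hgam, ← integral_const_mul]
    refine norm_integral_le_of_norm_le (hgi.const_mul 2) ?_
    filter_upwards [ae_restrict_mem measurableSet_Ioi] with q hq
    have hq0 : 0 < q := hq
    set z : ℂ := ((q ^ β : ℝ) : ℂ) * Complex.exp (β * ψ * Complex.I) with hz
    have hzn : ‖z‖ = q ^ β := by
      rw [hz, norm_mul, ← Complex.ofReal_mul, Complex.norm_exp_ofReal_mul_I, mul_one,
        Complex.norm_of_nonneg (Real.rpow_nonneg hq0.le β)]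
    have hzre : 0 ≤ z.re := by
      rw [hz, Complex.re_ofReal_mul, ← Complex.ofReal_mul, Complex.exp_ofReal_mul_I_re]
      exact mul_nonneg (Real.rpow_nonneg hq0.le β) h4.le
    have heq : rayIntegrand β y ψ q - E * Complex.exp (y * E * q) =
        E * Complex.exp (y * E * q) * (Complex.exp (-z) - 1) := by
      rw [rayIntegrand, ← hz, ← hE, sub_eq_add_neg (_ * E), Complex.exp_add,
        show (q : ℂ) * y * E = y * E * q by ring]
      ring
    rw [heq, norm_mul, norm_mul, hE, Complex.norm_exp_ofReal_mul_I, one_mul, ← hE,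
      Complex.norm_exp, Complex.re_mul_ofReal, hEre, add_sub_cancel_left]
    have := norm_exp_neg_sub_one_le hzre
    rw [hzn] at this
    calc Real.exp (-(ρ * y) * q) * ‖Complex.exp (-z) - 1‖
        ≤ Real.exp (-(ρ * y) * q) * (2 * q ^ β) := by gcongr
      _ = _ := by rw [neg_mul]; ring
  rw [hG, abs_mul, abs_of_nonneg (by positivity : (0 : ℝ) ≤ 1 / Real.pi), mul_assoc]
  refine mul_le_mul_of_nonneg_left ((Complex.abs_im_le_norm _).trans (hfin.trans_eq ?_))
    (by positivity)
  rw [← div_div, Real.div_rpow (by positivity) hy.le, Real.rpow_neg hy.le]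
  ring

end StableDensityTail

/-! ### Total mass of the density, and the Mittag-Leffler weight -/

section StableDensityMass

theorem integrable_stableDensity {β : ℝ} (hβ₀ : 0 < β) (hβ₁ : β < 1) :
    Integrable (stableDensity β 1) := by
  have hc := continuous_stableDensity hβ₀ hβ₁
  obtain ⟨C, -, hC⟩ := exists_abs_stableDensity_le_rpow hβ₀ hβ₁
  have h1 : IntegrableOn (stableDensity β 1) (Iio 0) :=
    (integrableOn_zero (ε' := ℝ)).congr_fun (fun y hy => (stableDensity_of_neg hβ₀ hβ₁ hy).symm)
      measurableSet_Iio
  have h2 : IntegrableOn (stableDensity β 1) (Icc 0 1) := hc.continuousOn.integrableOn_Icc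
  have h3 : IntegrableOn (stableDensity β 1) (Ioi 1) := by
    refine Integrable.mono' ((integrableOn_Ioi_rpow_of_lt (a := -(1 + β)) (by linarith)
      one_pos).const_mul C) hc.aestronglyMeasurable ?_
    filter_upwards [ae_restrict_mem measurableSet_Ioi] with y hy
    exact hC y (lt_trans one_pos hy)
  rw [← integrableOn_univ]
  refine ((h1.union h2).union h3).mono_set fun y _ => ?_
  rcases lt_or_ge y 0 with h | h
  · exact Or.inl (Or.inl h)
  · rcases le_or_gt y 1 with h' | h'
    · exact Or.inl (Or.inr ⟨h, h'⟩)
    · exact Or.inr h'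

theorem bromwichIntegrand_conj {β y : ℝ} {s : ℂ} (hs : s.arg ≠ Real.pi) :
    bromwichIntegrand β y (starRingEnd ℂ s) = starRingEnd ℂ (bromwichIntegrand β y s) := by
  unfold bromwichIntegrand
  have h := Complex.cpow_conj s (β : ℂ) hs
  rw [Complex.conj_ofReal] at h
  rw [← Complex.exp_conj, map_sub, map_mul, Complex.conj_ofReal, h, Complex.conj_conj]

theorem bromwichIntegrand_neg_mul_I (β y τ : ℝ) :
    bromwichIntegrand β y (((-τ : ℝ) : ℂ) * Complex.I) =
      starRingEnd ℂ (bromwichIntegrand β y (τ * Complex.I)) := by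
  rw [← bromwichIntegrand_conj]
  · congr 1
    simp
  · intro h
    have := (Complex.arg_eq_pi_iff.1 h).1
    simp at this

theorem integrable_bromwichIntegrand_mul_I {β : ℝ} (hβ₀ : 0 < β) (hβ₁ : β < 1) (y : ℝ) :
    Integrable fun τ : ℝ => bromwichIntegrand β y (τ * Complex.I) := by
  have h1 : IntegrableOn (fun τ : ℝ => bromwichIntegrand β y (τ * Complex.I)) (Ioi 0) := by
    simpa using integrableOn_bromwichIntegrand_line hβ₀ hβ₁ y le_rfl
  have h2 : IntegrableOn (fun τ : ℝ => bromwichIntegrand β y (τ * Complex.I)) (Iic 0) := by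
    rw [← integrableOn_Ici_iff_integrableOn_Ioi] at h1
    have h3 : IntegrableOn (fun τ : ℝ => bromwichIntegrand β y (((-τ : ℝ) : ℂ) * Complex.I))
        (Ici (-0)) := by
      rw [neg_zero]
      refine Integrable.mono h1 (Continuous.aestronglyMeasurable ?_)
        (Eventually.of_forall fun τ => ?_)
      · exact (continuousOn_bromwichIntegrand hβ₀ y).comp_continuous (by fun_prop) (by simp)
      · rw [bromwichIntegrand_neg_mul_I, RCLike.norm_conj]
    have := h3.comp_neg_Iic (c := 0)
    simpa using this
  rw [← integrableOn_univ, ← Iic_union_Ioi (a := (0 : ℝ))]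
  exact h2.union h1

/-- The values at τ and -τ are conjugate, so the integral over the line is twice the real part over
the half-line. This exhibits the density as a Fourier transform. -/
theorem integral_bromwichIntegrand_mul_I {β : ℝ} (hβ₀ : 0 < β) (hβ₁ : β < 1) (y : ℝ) :
    ∫ τ : ℝ, bromwichIntegrand β y (τ * Complex.I) =
      ((2 * Real.pi * stableDensity β 1 y : ℝ) : ℂ) := by
  have hi := integrable_bromwichIntegrand_mul_I hβ₀ hβ₁ y
  rw [← intervalIntegral.integral_Iic_add_Ioi (b := (0 : ℝ)) hi.integrableOn hi.integrableOn]
  have h1 := integral_comp_neg_Ioi 0 (fun τ : ℝ => bromwichIntegrand β y (τ * Complex.I))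
  rw [neg_zero] at h1
  rw [← h1]
  simp_rw [bromwichIntegrand_neg_mul_I]
  rw [integral_conj, add_comm, Complex.add_conj, stableDensity_eq]
  have h2 : ∀ x : ℝ, 2 * Real.pi * (1 / Real.pi * x) = 2 * x := fun x => by
    have := Real.pi_ne_zero
    field_simp
  rw [h2]

theorem fourier_bromwichIntegrand {β : ℝ} (hβ₀ : 0 < β) (hβ₁ : β < 1) (w : ℝ) :
    FourierTransform.fourier (fun τ : ℝ => bromwichIntegrand β 0 (τ * Complex.I)) w =
      ((2 * Real.pi * stableDensity β 1 (-(2 * Real.pi) * w) : ℝ) : ℂ) := by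
  rw [← integral_bromwichIntegrand_mul_I hβ₀ hβ₁, Real.fourier_real_eq_integral_exp_smul]
  refine integral_congr_ae (Eventually.of_forall fun τ => ?_)
  simp only [bromwichIntegrand, smul_eq_mul, ← Complex.exp_add]
  congr 1
  push_cast
  ring

/-- Fourier inversion at 0: the function τ ↦ exp(-(iτ)^β) is continuous and integrable with
integrable transform, and equals 1 at 0. The negative axis contributes nothing. -/
theorem integral_stableDensity {β : ℝ} (hβ₀ : 0 < β) (hβ₁ : β < 1) :
    ∫ y in Ioi (0 : ℝ), stableDensity β 1 y = 1 := by
  have hπ := Real.pi_pos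
  set F : ℝ → ℂ := fun τ => bromwichIntegrand β 0 (τ * Complex.I) with hF
  have hFc : Continuous F := by
    simpa using continuousOn_bromwichIntegrand_line hβ₀ 0 le_rfl
  have hFi : Integrable F := integrable_bromwichIntegrand_mul_I hβ₀ hβ₁ 0
  have hfour : FourierTransform.fourier F =
      fun w => ((2 * Real.pi * stableDensity β 1 (-(2 * Real.pi) * w) : ℝ) : ℂ) :=
    funext fun w => fourier_bromwichIntegrand hβ₀ hβ₁ w
  have hGi := integrable_stableDensity hβ₀ hβ₁
  have hi : Integrable (FourierTransform.fourier F) := by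
    rw [hfour]
    exact ((hGi.comp_mul_left' (by nlinarith : -(2 * Real.pi) ≠ 0)).const_mul _).ofReal
  have hinv := congrFun (hFc.fourierInv_fourier_eq hFi hi) 0
  rw [Real.fourierInv_eq', hfour] at hinv
  have hF0 : F 0 = 1 := by
    simp [hF, bromwichIntegrand, Complex.zero_cpow (show (β : ℂ) ≠ 0 by exact_mod_cast hβ₀.ne')]
  rw [hF0] at hinv
  simp only [inner_zero_right, mul_zero, Complex.ofReal_zero, zero_mul, Complex.exp_zero,
    one_smul] at hinv
  rw [integral_complex_ofReal, integral_const_mul,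
    Measure.integral_comp_mul_left (stableDensity β 1) (-(2 * Real.pi)), smul_eq_mul,
    abs_inv, abs_neg, abs_of_pos (by positivity), mul_inv_cancel_left₀ (by positivity)] at hinv
  have hall : ∫ y, stableDensity β 1 y = 1 := by exact_mod_cast hinv
  rw [← integral_Ici_eq_integral_Ioi]
  refine Eq.trans ?_ hall
  refine setIntegral_eq_integral_of_forall_compl_eq_zero fun y hy => ?_
  exact stableDensity_of_neg hβ₀ hβ₁ (not_le.1 hy)

/-- The density `x ^ (-1 - 1/β) G_β(1, x ^ (-1/β))`, with total mass `β`, of the weights in the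
Mittag-Leffler operator. -/
noncomputable def wrightWeight (β x : ℝ) : ℝ :=
  x ^ (-1 - 1 / β) * stableDensity β 1 (x ^ (-1 / β))

theorem continuousOn_wrightWeight {β : ℝ} (hβ₀ : 0 < β) (hβ₁ : β < 1) :
    ContinuousOn (wrightWeight β) (Ioi 0) := by
  have h : ∀ p : ℝ, ContinuousOn (fun x : ℝ => x ^ p) (Ioi 0) := fun p x hx =>
    (Real.continuousAt_rpow_const x p (Or.inl (ne_of_gt hx))).continuousWithinAt
  exact (h _).mul ((continuous_stableDensity hβ₀ hβ₁).comp_continuousOn (h _))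

/-- Put y = x^(-1/β). For x ≤ 1 the tail y^(-1-β) cancels x^(-1-1/β) exactly; for x ≥ 1 the decay
exp(-μ y^(-β)) is exp(-μx). -/
theorem exists_abs_wrightWeight_le {β : ℝ} (hβ₀ : 0 < β) (hβ₁ : β < 1) {μ : ℝ} (hμ : 0 < μ) :
    ∃ C : ℝ, 0 ≤ C ∧ ∀ x, 0 < x → |wrightWeight β x| ≤ C * Real.exp (-μ * x) := by
  obtain ⟨C₁, hC₁, h₁⟩ := exists_abs_stableDensity_le_rpow hβ₀ hβ₁
  obtain ⟨C₂, hC₂, h₂⟩ := exists_abs_stableDensity_le_exp hβ₀ hβ₁ hμ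
  refine ⟨C₁ * Real.exp μ + C₂, by positivity, fun x hx => ?_⟩
  have hp : 0 < x ^ (-1 / β) := Real.rpow_pos_of_pos hx _
  have hq : 0 < x ^ (-1 - 1 / β) := Real.rpow_pos_of_pos hx _
  rw [wrightWeight, abs_mul, abs_of_pos hq]
  rcases le_total x 1 with h | h
  · calc x ^ (-1 - 1 / β) * |stableDensity β 1 (x ^ (-1 / β))|
        ≤ x ^ (-1 - 1 / β) * (C₁ * (x ^ (-1 / β)) ^ (-(1 + β))) := by gcongr; exact h₁ _ hp
      _ = C₁ * 1 := by
          rw [mul_left_comm, ← Real.rpow_mul hx.le, ← Real.rpow_add hx]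
          congr 1
          rw [show -1 - 1 / β + -1 / β * -(1 + β) = 0 by field_simp; ring, Real.rpow_zero]
      _ ≤ C₁ * Real.exp (μ + -μ * x) := by
          gcongr
          exact Real.one_le_exp (by nlinarith)
      _ ≤ _ := by
          rw [Real.exp_add, add_mul, mul_assoc]
          have : 0 ≤ C₂ * Real.exp (-μ * x) := by positivity
          linarith
  · calc x ^ (-1 - 1 / β) * |stableDensity β 1 (x ^ (-1 / β))|
        ≤ 1 * (C₂ * Real.exp (-μ * (x ^ (-1 / β)) ^ (-β))) := by
          gcongr
          · refine Real.rpow_le_one_of_one_le_of_nonpos h ?_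
            have : 0 < 1 / β := by positivity
            linarith
          · exact h₂ _ hp
      _ = C₂ * Real.exp (-μ * x) := by
          rw [one_mul, ← Real.rpow_mul hx.le, show -1 / β * -β = 1 by field_simp, Real.rpow_one]
      _ ≤ _ := by
          rw [add_mul]
          have : 0 ≤ C₁ * Real.exp μ * Real.exp (-μ * x) := by positivity
          linarith

theorem integral_wrightWeight {β : ℝ} (hβ₀ : 0 < β) (hβ₁ : β < 1) :
    ∫ x in Ioi (0 : ℝ), wrightWeight β x = β := by
  have h := integral_comp_rpow_Ioi (stableDensity β 1) (p := -1 / β)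
    (by rw [neg_div]; exact neg_ne_zero.2 (by positivity))
  rw [integral_stableDensity hβ₀ hβ₁] at h
  have h2 : ∀ x : ℝ, (|-1 / β| * x ^ (-1 / β - 1)) • stableDensity β 1 (x ^ (-1 / β)) =
      (1 / β) * wrightWeight β x := by
    intro x
    rw [wrightWeight, smul_eq_mul, neg_div, abs_neg, abs_of_pos (by positivity),
      show -(1 / β) - 1 = -1 - 1 / β by ring]
    ring
  simp_rw [h2] at h
  rw [integral_const_mul] at h
  field_simp at h
  exact h

end StableDensityMass

/-! ### Mittag-Leffler operators as bounded propagators -/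

section MittagLeffler

theorem SingularKernel.mono {F X : Type*} [NormedAddCommGroup F] [NormedAddCommGroup X]
    {K : ℝ → F → X} {C C' γ : ℝ} (hK : SingularKernel K C γ) (h : C ≤ C') :
    SingularKernel K C' γ where
  map_sub := hK.map_sub
  bound t ht v := (hK.bound t ht v).trans (by
    have := Real.rpow_nonneg ht.1.le (-γ)
    gcongr)
  continuousOn := hK.continuousOn
  nonneg := hK.nonneg.trans h
  lt_one := hK.lt_one

theorem BoundedPropagator.mono {X : Type*} [NormedAddCommGroup X]
    {P : ℝ → X → X} {C C' : ℝ} (hP : BoundedPropagator P C) (h : C ≤ C') :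
    BoundedPropagator P C' where
  map_sub := hP.map_sub
  bound t ht v := (hP.bound t ht v).trans (by gcongr)
  continuousOn := hP.continuousOn

variable {X : Type*} [NormedAddCommGroup X] [NormedSpace ℝ X]

theorem mittagLeffler_eq (S : C0Semigroup X) (β τ : ℝ) (v : X) :
    mittagLeffler S β τ v =
      (1 / β) • ∫ x in Ioi (0 : ℝ), wrightWeight β x • S.op (τ * x) v := rfl

theorem mittagLefflerDeriv_eq (S : C0Semigroup X) (β τ : ℝ) (v : X) :
    mittagLefflerDeriv S β τ v =
      (1 / β) • ∫ x in Ioi (0 : ℝ), (x * wrightWeight β x) • S.op (τ * x) v := by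
  rw [mittagLefflerDeriv]
  congr 1
  refine setIntegral_congr_fun measurableSet_Ioi fun x (hx : 0 < x) => ?_
  have hpow : x ^ (-1 / β) = x * x ^ (-1 - 1 / β) := by
    rw [show -1 / β = 1 + (-1 - 1 / β) by ring, Real.rpow_add hx, Real.rpow_one]
  simp only [wrightWeight]
  rw [← mul_assoc, ← hpow]

theorem continuousOn_op_mul (S : C0Semigroup X) {τ : ℝ} (hτ : 0 ≤ τ) (v : X) :
    ContinuousOn (fun x => S.op (τ * x) v) (Ioi 0) :=
  (S.strongly_continuous v).comp (by fun_prop) fun x (hx : 0 < x) => mul_nonneg hτ hx.le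

theorem aestronglyMeasurable_wrightWeight_smul {β : ℝ} (hβ₀ : 0 < β) (hβ₁ : β < 1)
    (S : C0Semigroup X) {τ : ℝ} (hτ : 0 ≤ τ) (v : X) :
    AEStronglyMeasurable (fun x => wrightWeight β x • S.op (τ * x) v)
      (volume.restrict (Ioi 0)) :=
  ((continuousOn_wrightWeight hβ₀ hβ₁).smul (continuousOn_op_mul S hτ v)).aestronglyMeasurable
    measurableSet_Ioi

theorem exists_norm_wrightWeight_smul_le {β : ℝ} (hβ₀ : 0 < β) (hβ₁ : β < 1)
    (S : C0Semigroup X) (hS : ∃ M m : ℝ, 0 ≤ M ∧ 0 ≤ m ∧ ∀ t, 0 ≤ t →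
      ‖S.op t‖ ≤ M * Real.exp (m * t)) :
    ∃ C : ℝ, 0 ≤ C ∧ ∀ τ ∈ Icc (0 : ℝ) 1, ∀ v, ∀ x ∈ Ioi (0 : ℝ),
      ‖wrightWeight β x • S.op (τ * x) v‖ ≤ C * ‖v‖ * Real.exp (-x) := by
  obtain ⟨M, m, hM, hm, hg⟩ := hS
  -- The rate m + 1 absorbs the growth exp(mτx), τ ≤ 1, and leaves exp(-x) uniformly in τ.
  obtain ⟨C, hC, hw⟩ := exists_abs_wrightWeight_le hβ₀ hβ₁ (show 0 < m + 1 by linarith)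
  refine ⟨C * M, by positivity, fun τ hτ v x (hx : 0 < x) => ?_⟩
  have h0 : 0 ≤ τ * x := mul_nonneg hτ.1 hx.le
  rw [norm_smul, Real.norm_eq_abs]
  calc |wrightWeight β x| * ‖S.op (τ * x) v‖
      ≤ (C * Real.exp (-(m + 1) * x)) * (M * Real.exp (m * (τ * x)) * ‖v‖) := by
        gcongr
        · exact hw x hx
        · exact (S.op (τ * x)).le_of_opNorm_le (hg _ h0) v
    _ ≤ (C * Real.exp (-(m + 1) * x)) * (M * Real.exp (m * x) * ‖v‖) := by
        gcongr
        exact mul_le_of_le_one_left hx.le hτ.2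
    _ = C * M * ‖v‖ * (Real.exp (-(m + 1) * x) * Real.exp (m * x)) := by ring
    _ = C * M * ‖v‖ * Real.exp (-x) := by rw [← Real.exp_add]; ring_nf

theorem integrableOn_exp_neg_Ioi_zero : IntegrableOn (fun x : ℝ => Real.exp (-x)) (Ioi 0) := by
  simpa using integrableOn_exp_mul_Ioi (a := -1) (by norm_num) 0

theorem integrableOn_wrightWeight_smul {β : ℝ} (hβ₀ : 0 < β) (hβ₁ : β < 1)
    (S : C0Semigroup X) (hS : ∃ M m : ℝ, 0 ≤ M ∧ 0 ≤ m ∧ ∀ t, 0 ≤ t →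
      ‖S.op t‖ ≤ M * Real.exp (m * t)) {τ : ℝ} (hτ : τ ∈ Icc (0 : ℝ) 1) (v : X) :
    IntegrableOn (fun x => wrightWeight β x • S.op (τ * x) v) (Ioi 0) := by
  obtain ⟨C, -, hC⟩ := exists_norm_wrightWeight_smul_le hβ₀ hβ₁ S hS
  refine Integrable.mono' (integrableOn_exp_neg_Ioi_zero.const_mul (C * ‖v‖))
    (aestronglyMeasurable_wrightWeight_smul hβ₀ hβ₁ S hτ.1 v) ?_
  filter_upwards [ae_restrict_mem measurableSet_Ioi] with x hx using hC τ hτ v x hx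

theorem exists_boundedPropagator_mittagLeffler {β : ℝ} (hβ₀ : 0 < β) (hβ₁ : β < 1)
    (S : C0Semigroup X) (hS : ∃ M m : ℝ, 0 ≤ M ∧ 0 ≤ m ∧ ∀ t, 0 ≤ t →
      ‖S.op t‖ ≤ M * Real.exp (m * t)) :
    ∃ C, BoundedPropagator (fun t => mittagLeffler S β (t ^ β)) C := by
  obtain ⟨C, hC0, hC⟩ := exists_norm_wrightWeight_smul_le hβ₀ hβ₁ S hS
  have hpow : ∀ t ∈ Icc (0 : ℝ) 1, t ^ β ∈ Icc (0 : ℝ) 1 := fun t ht =>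
    ⟨Real.rpow_nonneg ht.1 _, Real.rpow_le_one ht.1 ht.2 hβ₀.le⟩
  refine ⟨1 / β * C, fun t ht v w => ?_, fun t ht v => ?_, fun v => ?_⟩
  · simp_rw [mittagLeffler_eq]
    rw [← smul_sub, ← integral_sub (integrableOn_wrightWeight_smul hβ₀ hβ₁ S hS (hpow t ht) v)
      (integrableOn_wrightWeight_smul hβ₀ hβ₁ S hS (hpow t ht) w)]
    simp_rw [map_sub, smul_sub]
  · rw [mittagLeffler_eq, norm_smul, Real.norm_of_nonneg (by positivity), mul_assoc]
    gcongr
    have h1 : ∫ x in Ioi (0 : ℝ), C * ‖v‖ * Real.exp (-x) = C * ‖v‖ := by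
      rw [integral_const_mul, integral_exp_neg_Ioi_zero, mul_one]
    rw [← h1]
    refine norm_integral_le_of_norm_le (integrableOn_exp_neg_Ioi_zero.const_mul _) ?_
    filter_upwards [ae_restrict_mem measurableSet_Ioi] with x hx using hC _ (hpow t ht) v x hx
  · simp_rw [mittagLeffler_eq]
    refine ContinuousOn.const_smul ?_ _
    refine continuousOn_of_dominated (bound := fun x => C * ‖v‖ * Real.exp (-x))
      (fun t ht => aestronglyMeasurable_wrightWeight_smul hβ₀ hβ₁ S (hpow t ht).1 v)
      (fun t ht => ?_) (integrableOn_exp_neg_Ioi_zero.const_mul _) ?_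
    · filter_upwards [ae_restrict_mem measurableSet_Ioi] with x hx using hC _ (hpow t ht) v x hx
    · filter_upwards [ae_restrict_mem measurableSet_Ioi] with x hx
      refine ContinuousOn.const_smul ?_ _
      refine (S.strongly_continuous v).comp (ContinuousOn.mul ?_ continuousOn_const) fun t ht =>
        mul_nonneg (hpow t ht).1 (le_of_lt hx)
      exact (Real.continuous_rpow_const hβ₀.le).continuousOn

/-- The exact mass β of the weight enters here; it makes the initial condition follow from the
integral equation. -/
theorem mittagLeffler_zero [CompleteSpace X] {β : ℝ} (hβ₀ : 0 < β) (hβ₁ : β < 1)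
    (S : C0Semigroup X) (v : X) : mittagLeffler S β 0 v = v := by
  rw [mittagLeffler_eq]
  simp_rw [zero_mul, S.op_zero, ContinuousLinearMap.id_apply]
  rw [integral_smul_const, integral_wrightWeight hβ₀ hβ₁, smul_smul, one_div_mul_cancel hβ₀.ne',
    one_smul]

end MittagLeffler

/-! ### The smoothing semigroup and the fractional kernel, from B to B₁ -/

section Smoothing

variable {B₂ B₁ B : Type*}
  [NormedAddCommGroup B₂] [NormedSpace ℝ B₂] [CompleteSpace B₂]
  [NormedAddCommGroup B₁] [NormedSpace ℝ B₁] [CompleteSpace B₁]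
  [NormedAddCommGroup B] [NormedSpace ℝ B] [CompleteSpace B]

/-- The operators `R t = e^{At}`, `t > 0`, seen as maps `B → B₁`. -/
structure IsSmoothingFamily (E : BanachTriple B₂ B₁ B) (S : C0Semigroup B) (R : ℝ → B → B₁)
    (κ ω μ : ℝ) : Prop where
  incl : ∀ t, 0 < t → ∀ v, E.incl₁ (R t v) = S.op t v
  bound : ∀ t, 0 < t → ∀ v, ‖R t v‖ ≤ κ * t ^ (-ω) * Real.exp (μ * t) * ‖v‖
  continuousOn : ∀ v, ContinuousOn (fun t => R t v) (Ioi 0)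
  nonneg : 0 ≤ κ
  pos : 0 < ω
  lt_one : ω < 1
  exponent_nonneg : 0 ≤ μ

/-- A bound for all t > 0 is needed because the fractional kernel averages over all times; beyond 1
it comes from e^{tA} = e^{A} e^{(t-1)A}. Continuity into B₁ near t₀ comes from factoring through
time t₀/2 and the strong continuity of the semigroup in B₁. -/
theorem exists_isSmoothingFamily {E : BanachTriple B₂ B₁ B} {A : B₂ →L[ℝ] B} {S : C0Semigroup B}
    {S₁ : C0Semigroup B₁} (hA : GeneratesOnTriple E A S S₁) (hS : IsSmoothing E S) :
    ∃ R κ ω μ, IsSmoothingFamily E S R κ ω μ := by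
  obtain ⟨κ, ω, hκ, hω₀, hω₁, h⟩ := hS
  obtain ⟨M, m, hM, hm, hg⟩ := hA.growth
  have hch : ∀ t v, ∃ w : B₁, 0 < t → E.incl₁ w = S.op t v ∧
      (t ≤ 1 → ‖w‖ ≤ κ * t ^ (-ω) * ‖v‖) := by
    intro t v
    by_cases ht : 0 < t
    · obtain ⟨w, hw⟩ := h t ht v
      exact ⟨w, fun _ => hw⟩
    · exact ⟨0, fun h' => absurd h' ht⟩
  choose R hR using hch
  have hincl : ∀ t, 0 < t → ∀ v, E.incl₁ (R t v) = S.op t v := fun t ht v => (hR t v ht).1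
  refine ⟨R, κ * (M + 1), ω, m + 1, hincl, fun t ht v => ?_, fun v t₀ ht₀ => ?_, by positivity,
    hω₀, hω₁, by linarith⟩
  · have hpow : 0 ≤ t ^ (-ω) := Real.rpow_nonneg ht.le _
    rcases le_or_gt t 1 with h1 | h1
    · refine ((hR t v ht).2 h1).trans ?_
      have e1 : 1 ≤ Real.exp ((m + 1) * t) := Real.one_le_exp (by positivity)
      have e2 : 1 * 1 ≤ (M + 1) * Real.exp ((m + 1) * t) := by gcongr; linarith
      have e3 : 0 ≤ κ * t ^ (-ω) := by positivity
      calc κ * t ^ (-ω) * ‖v‖ = κ * t ^ (-ω) * (1 * 1) * ‖v‖ := by ring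
        _ ≤ κ * t ^ (-ω) * ((M + 1) * Real.exp ((m + 1) * t)) * ‖v‖ := by gcongr
        _ = _ := by ring
    · have e0 : R t v = R 1 (S.op (t - 1) v) := by
        apply E.incl₁_injective
        rw [hincl t ht, hincl 1 one_pos, ← ContinuousLinearMap.comp_apply,
          ← S.op_add 1 (t - 1) zero_le_one (by linarith)]
        congr 2
        ring
      have e1 : ‖R t v‖ ≤ κ * (M * Real.exp (m * (t - 1)) * ‖v‖) := by
        rw [e0]
        refine ((hR 1 _ one_pos).2 le_rfl).trans ?_
        rw [Real.one_rpow, mul_one]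
        gcongr
        exact (S.op (t - 1)).le_of_opNorm_le (hg _ (by linarith)) v
      -- Inserts the missing power of t for t > 1 at the cost of raising the exponential rate from m
      -- to m + 1.
      have e2 : 1 ≤ t ^ (-ω) * Real.exp t := by
        have : t ^ (-1 : ℝ) ≤ t ^ (-ω) := Real.rpow_le_rpow_of_exponent_le h1.le (by linarith)
        rw [Real.rpow_neg_one] at this
        have h3 : t ≤ Real.exp t := by linarith [Real.add_one_le_exp t]
        calc (1 : ℝ) = t⁻¹ * t := (inv_mul_cancel₀ ht.ne').symm
          _ ≤ _ := by gcongr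
      refine e1.trans ?_
      calc κ * (M * Real.exp (m * (t - 1)) * ‖v‖) = κ * M * 1 * Real.exp (m * (t - 1)) * ‖v‖ := by
            ring
        _ ≤ κ * (M + 1) * (t ^ (-ω) * Real.exp t) * Real.exp (m * t) * ‖v‖ := by
            gcongr <;> linarith
        _ = κ * (M + 1) * t ^ (-ω) * (Real.exp t * Real.exp (m * t)) * ‖v‖ := by ring
        _ = _ := by rw [← Real.exp_add]; ring_nf
  · have ht₀' : (0 : ℝ) < t₀ := ht₀
    have hc : ContinuousAt (fun t => S₁.op (t - t₀ / 2) (R (t₀ / 2) v)) t₀ := by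
      have h1 : ContinuousAt (fun t => S₁.op t (R (t₀ / 2) v)) (t₀ - t₀ / 2) :=
        (S₁.strongly_continuous _).continuousAt (Ici_mem_nhds (by linarith))
      exact ContinuousAt.comp (f := fun t => t - t₀ / 2) h1 (by fun_prop)
    refine (hc.congr ?_).continuousWithinAt
    filter_upwards [lt_mem_nhds (show t₀ / 2 < t₀ by linarith)] with t ht
    apply E.incl₁_injective
    rw [hA.restrict _ (by linarith), hincl _ (by linarith), hincl _ (by linarith),
      ← ContinuousLinearMap.comp_apply, ← S.op_add _ _ (by linarith) (by linarith),
      sub_add_cancel]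

namespace IsSmoothingFamily

variable {E : BanachTriple B₂ B₁ B} {S : C0Semigroup B} {R : ℝ → B → B₁} {κ ω μ : ℝ}

theorem map_sub (hR : IsSmoothingFamily E S R κ ω μ) {t : ℝ} (ht : 0 < t) (v w : B) :
    R t (v - w) = R t v - R t w := by
  apply E.incl₁_injective
  rw [_root_.map_sub, hR.incl t ht, hR.incl t ht, hR.incl t ht, _root_.map_sub]

theorem singularKernel (hR : IsSmoothingFamily E S R κ ω μ) :
    SingularKernel R (κ * Real.exp μ) ω where
  map_sub t ht := hR.map_sub ht.1
  bound t ht v := (hR.bound t ht.1 v).trans (by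
    have h1 := hR.nonneg
    have h2 := Real.rpow_nonneg ht.1.le (-ω)
    have h3 : Real.exp (μ * t) ≤ Real.exp μ :=
      Real.exp_le_exp.2 (mul_le_of_le_one_right hR.exponent_nonneg ht.2)
    calc κ * t ^ (-ω) * Real.exp (μ * t) * ‖v‖ ≤ κ * t ^ (-ω) * Real.exp μ * ‖v‖ := by gcongr
      _ = _ := by ring)
  continuousOn v := (hR.continuousOn v).mono fun _ h => h.1
  nonneg := mul_nonneg hR.nonneg (Real.exp_pos _).le
  lt_one := hR.lt_one

theorem aestronglyMeasurable_smul (hR : IsSmoothingFamily E S R κ ω μ) {β : ℝ} (hβ₀ : 0 < β)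
    (hβ₁ : β < 1) {τ : ℝ} (hτ : 0 < τ) (v : B) :
    AEStronglyMeasurable (fun x => (x * wrightWeight β x) • R (τ * x) v)
      (volume.restrict (Ioi 0)) := by
  refine ContinuousOn.aestronglyMeasurable ?_ measurableSet_Ioi
  refine (continuousOn_id.mul (continuousOn_wrightWeight hβ₀ hβ₁)).smul ?_
  exact (hR.continuousOn v).comp (by fun_prop) fun x (hx : 0 < x) => mul_pos hτ hx

/-- The singularity (τx)^(-ω) splits into τ^(-ω) and x^(-ω). With the factor x from E_β' the latter
gives x^(1-ω), written as the integrand of Γ(2-ω). -/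
theorem exists_norm_smul_le (hR : IsSmoothingFamily E S R κ ω μ) {β : ℝ} (hβ₀ : 0 < β)
    (hβ₁ : β < 1) : ∃ C : ℝ, 0 ≤ C ∧ ∀ τ ∈ Ioc (0 : ℝ) 1, ∀ v, ∀ x ∈ Ioi (0 : ℝ),
      ‖(x * wrightWeight β x) • R (τ * x) v‖ ≤
        C * τ ^ (-ω) * ‖v‖ * (Real.exp (-x) * x ^ (2 - ω - 1)) := by
  have hκ := hR.nonneg
  have hμ := hR.exponent_nonneg
  obtain ⟨C, hC, hw⟩ := exists_abs_wrightWeight_le hβ₀ hβ₁ (show 0 < μ + 1 by linarith)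
  refine ⟨C * κ, by positivity, fun τ hτ v x (hx : 0 < x) => ?_⟩
  have h0 : 0 < τ * x := mul_pos hτ.1 hx
  have hτp : 0 ≤ τ ^ (-ω) := Real.rpow_nonneg hτ.1.le _
  have hxp : 0 ≤ x ^ (-ω) := Real.rpow_nonneg hx.le _
  rw [norm_smul, Real.norm_eq_abs, abs_mul, abs_of_pos hx]
  calc x * |wrightWeight β x| * ‖R (τ * x) v‖
      ≤ x * (C * Real.exp (-(μ + 1) * x)) *
        (κ * (τ * x) ^ (-ω) * Real.exp (μ * (τ * x)) * ‖v‖) := by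
        gcongr
        · exact hw x hx
        · exact hR.bound _ h0 v
    _ ≤ x * (C * Real.exp (-(μ + 1) * x)) *
        (κ * (τ ^ (-ω) * x ^ (-ω)) * Real.exp (μ * x) * ‖v‖) := by
        rw [Real.mul_rpow hτ.1.le hx.le]
        gcongr
        exact mul_le_of_le_one_left hx.le hτ.2
    _ = C * κ * τ ^ (-ω) * ‖v‖ * ((Real.exp (-(μ + 1) * x) * Real.exp (μ * x)) *
        (x ^ (1 : ℝ) * x ^ (-ω))) := by rw [Real.rpow_one]; ring
    _ = _ := by
        rw [← Real.exp_add, ← Real.rpow_add hx]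
        ring_nf

/-- The kernel `β t ^ (β - 1) E_β'(A t ^ β)` as a map `B → B₁`. -/
noncomputable def _root_.fractionalKernel (R : ℝ → B → B₁) (β t : ℝ) (v : B) : B₁ :=
  t ^ (β - 1) • ∫ x in Ioi (0 : ℝ), (x * wrightWeight β x) • R (t ^ β * x) v

theorem integrableOn_smul (hR : IsSmoothingFamily E S R κ ω μ) {β : ℝ} (hβ₀ : 0 < β)
    (hβ₁ : β < 1) {τ : ℝ} (hτ : τ ∈ Ioc (0 : ℝ) 1) (v : B) :
    IntegrableOn (fun x => (x * wrightWeight β x) • R (τ * x) v) (Ioi 0) := by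
  obtain ⟨C, -, hC⟩ := hR.exists_norm_smul_le hβ₀ hβ₁
  have hω := hR.lt_one
  refine Integrable.mono' ((Real.GammaIntegral_convergent (show 0 < 2 - ω by linarith)).const_mul
    (C * τ ^ (-ω) * ‖v‖)) (hR.aestronglyMeasurable_smul hβ₀ hβ₁ hτ.1 v) ?_
  filter_upwards [ae_restrict_mem measurableSet_Ioi] with x hx using hC τ hτ v x hx

theorem incl_fractionalKernel (hR : IsSmoothingFamily E S R κ ω μ) {β : ℝ} (hβ₀ : 0 < β)
    (hβ₁ : β < 1) {t : ℝ} (ht : t ∈ Ioc (0 : ℝ) 1) (v : B) :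
    E.incl₁ (fractionalKernel R β t v) =
      β • t ^ (β - 1) • mittagLefflerDeriv S β (t ^ β) v := by
  have hτ : t ^ β ∈ Ioc (0 : ℝ) 1 := ⟨Real.rpow_pos_of_pos ht.1 _,
    Real.rpow_le_one ht.1.le ht.2 hβ₀.le⟩
  rw [fractionalKernel, mittagLefflerDeriv_eq, map_smul,
    ← ContinuousLinearMap.integral_comp_comm _ (hR.integrableOn_smul hβ₀ hβ₁ hτ v),
    smul_comm β, smul_smul β, mul_one_div_cancel hβ₀.ne', one_smul]
  congr 1
  refine setIntegral_congr_fun measurableSet_Ioi fun x (hx : 0 < x) => ?_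
  simp only [map_smul]
  rw [hR.incl _ (mul_pos hτ.1 hx)]

/-- The prefactor t^(β-1) and the smoothing bound t^(-βω) multiply to the power -(1 - β + βω), which
exceeds -1 because ω < 1. -/
theorem exists_singularKernel_fractionalKernel (hR : IsSmoothingFamily E S R κ ω μ) {β : ℝ}
    (hβ₀ : 0 < β) (hβ₁ : β < 1) :
    ∃ C, SingularKernel (fractionalKernel R β) C (1 - β + β * ω) := by
  obtain ⟨C, hC0, hC⟩ := hR.exists_norm_smul_le hβ₀ hβ₁
  have hω := hR.lt_one
  have hGi := Real.GammaIntegral_convergent (show 0 < 2 - ω by linarith)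
  have hpow : ∀ t ∈ Ioc (0 : ℝ) 1, t ^ β ∈ Ioc (0 : ℝ) 1 := fun t ht =>
    ⟨Real.rpow_pos_of_pos ht.1 _, Real.rpow_le_one ht.1.le ht.2 hβ₀.le⟩
  have hΓ := Real.Gamma_pos_of_pos (show 0 < 2 - ω by linarith)
  refine ⟨C * Real.Gamma (2 - ω), fun t ht v w => ?_, fun t ht v => ?_, fun v => ?_,
    by positivity, by nlinarith⟩
  · simp only [fractionalKernel]
    rw [← smul_sub, ← integral_sub (hR.integrableOn_smul hβ₀ hβ₁ (hpow t ht) v)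
      (hR.integrableOn_smul hβ₀ hβ₁ (hpow t ht) w)]
    congr 1
    refine setIntegral_congr_fun measurableSet_Ioi fun x (hx : 0 < x) => ?_
    rw [hR.map_sub (mul_pos (hpow t ht).1 hx), smul_sub]
  · have h1 : ‖∫ x in Ioi (0 : ℝ), (x * wrightWeight β x) • R (t ^ β * x) v‖ ≤
        C * (t ^ β) ^ (-ω) * ‖v‖ * Real.Gamma (2 - ω) := by
      rw [Real.Gamma_eq_integral (by linarith), ← integral_const_mul]
      refine norm_integral_le_of_norm_le (hGi.const_mul _) ?_
      filter_upwards [ae_restrict_mem measurableSet_Ioi] with x hx using hC _ (hpow t ht) v x hx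
    rw [fractionalKernel, norm_smul, Real.norm_of_nonneg (Real.rpow_nonneg ht.1.le _)]
    calc t ^ (β - 1) * ‖∫ x in Ioi (0 : ℝ), (x * wrightWeight β x) • R (t ^ β * x) v‖
        ≤ t ^ (β - 1) * (C * (t ^ β) ^ (-ω) * ‖v‖ * Real.Gamma (2 - ω)) :=
          mul_le_mul_of_nonneg_left h1 (Real.rpow_nonneg ht.1.le _)
      _ = C * Real.Gamma (2 - ω) * (t ^ (β - 1) * (t ^ β) ^ (-ω)) * ‖v‖ := by ring
      _ = _ := by
          rw [← Real.rpow_mul ht.1.le, ← Real.rpow_add ht.1]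
          ring_nf
  · intro t₀ ht₀
    have hrp : ∀ p : ℝ, ContinuousAt (fun t : ℝ => t ^ p) t₀ := fun p =>
      Real.continuousAt_rpow_const t₀ p (Or.inl ht₀.1.ne')
    simp only [fractionalKernel]
    refine (hrp _).continuousWithinAt.smul ?_
    refine continuousWithinAt_of_dominated (bound := fun x =>
      C * ((t₀ / 2) ^ β) ^ (-ω) * ‖v‖ * (Real.exp (-x) * x ^ (2 - ω - 1))) ?_ ?_
      (hGi.const_mul _) ?_
    · filter_upwards [self_mem_nhdsWithin] with t ht
      exact hR.aestronglyMeasurable_smul hβ₀ hβ₁ (hpow t ht).1 v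
    · filter_upwards [self_mem_nhdsWithin,
        nhdsWithin_le_nhds (lt_mem_nhds (show t₀ / 2 < t₀ by linarith [ht₀.1]))] with t ht ht'
      filter_upwards [ae_restrict_mem measurableSet_Ioi] with x hx
      refine (hC _ (hpow t ht) v x hx).trans ?_
      have hx0 : (0 : ℝ) < x := hx
      have hh : 0 < t₀ / 2 := half_pos ht₀.1
      have h2 : (t ^ β) ^ (-ω) ≤ ((t₀ / 2) ^ β) ^ (-ω) :=
        Real.rpow_le_rpow_of_nonpos (Real.rpow_pos_of_pos hh _)
          (Real.rpow_le_rpow hh.le ht'.le hβ₀.le) (by linarith [hR.pos])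
      gcongr
    · filter_upwards [ae_restrict_mem measurableSet_Ioi] with x hx
      have hx0 : (0 : ℝ) < x := hx
      refine ContinuousAt.continuousWithinAt ?_
      refine ContinuousAt.const_smul ?_ _
      have h1 : ContinuousAt (fun s => R s v) (t₀ ^ β * x) :=
        (hR.continuousOn v).continuousAt (Ioi_mem_nhds (mul_pos (hpow t₀ ht₀).1 hx0))
      exact ContinuousAt.comp (f := fun t => t ^ β * x) h1 ((hrp β).mul continuousAt_const)

end IsSmoothingFamily

end Smoothing

/-! ### Mild solutions as Volterra solutions -/

section MildSolutions

variable {B₂ B₁ B P : Type*}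
  [NormedAddCommGroup B₂] [NormedSpace ℝ B₂] [CompleteSpace B₂]
  [NormedAddCommGroup B₁] [NormedSpace ℝ B₁] [CompleteSpace B₁]
  [NormedAddCommGroup B] [NormedSpace ℝ B] [CompleteSpace B]
  [NormedAddCommGroup P] [NormedSpace ℝ P] {n : ℕ}

theorem C0Semigroup.boundedPropagator {S : C0Semigroup B} {M m : ℝ} (hM : 0 ≤ M) (hm : 0 ≤ m)
    (hg : ∀ t, 0 ≤ t → ‖S.op t‖ ≤ M * Real.exp (m * t)) :
    BoundedPropagator (fun t v => S.op t v) (M * Real.exp m) where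
  map_sub t _ v w := map_sub _ v w
  bound t ht v := by
    refine (S.op t).le_of_opNorm_le ((hg t ht.1).trans ?_) v
    gcongr
    exact mul_le_of_le_one_right hm ht.2
  continuousOn v := (S.strongly_continuous v).mono Icc_subset_Ici_self

/-- A Volterra equation in `B₁` is equivalent to its image in `B` under the inclusion. -/
theorem isVolterraSolution_iff {E : BanachTriple B₂ B₁ B} {P₀ : ℝ → B → B} {K₀ : ℝ → B → B}
    {P₁ : ℝ → B₁ → B₁} {K : ℝ → B → B₁} {C γ : ℝ} (hK : SingularKernel K C γ)
    (hP₁ : ∀ t ∈ Icc (0 : ℝ) 1, ∀ v, E.incl₁ (P₁ t v) = P₀ t (E.incl₁ v))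
    (hP₁0 : ∀ v, P₁ 0 v = v)
    (hKK : ∀ t ∈ Ioc (0 : ℝ) 1, ∀ v, E.incl₁ (K t v) = K₀ t v)
    {a T : ℝ} (haT : a ≤ T) (hT : T ≤ a + 1) {N : C(Icc a T, B₁) → ℝ → B} {Y : B₁}
    {b : C(Icc a T, B₁)} (hN : Continuous (N b)) {Q : ℝ} (hQ : ∀ s, ‖N b s‖ ≤ Q) :
    IsVolterraSolution P₁ K N Y b ↔ b ⟨a, left_mem_Icc.2 haT⟩ = Y ∧ ∀ t : Icc a T,
      E.incl₁ (b t) = P₀ (t - a) (E.incl₁ Y) + ∫ s in a..t, K₀ (t - s) (N b s) := by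
  have key : ∀ t : Icc a T, E.incl₁ (P₁ (t - a) Y + ∫ s in a..t, K (t - s) (N b s)) =
      P₀ (t - a) (E.incl₁ Y) + ∫ s in a..t, K₀ (t - s) (N b s) := by
    intro t
    have hi := hK.intervalIntegrable hN hQ t.2.1 (by linarith [t.2.2])
    rw [map_add, hP₁ _ ⟨by linarith [t.2.1], by linarith [t.2.2]⟩,
      ← E.incl₁.intervalIntegral_comp_comm hi]
    congr 1
    refine intervalIntegral.integral_congr_ae ?_
    -- At s = t the kernel is evaluated at time 0, where the two kernels need not agree.
    have hne : ∀ᵐ s ∂(volume : Measure ℝ), s ≠ (t : ℝ) := by simp [ae_iff]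
    filter_upwards [hne] with s hs hs'
    rw [uIoc_of_le t.2.1] at hs'
    exact hKK _ ⟨sub_pos.2 (lt_of_le_of_ne hs'.2 hs), by linarith [hs'.1, t.2.2]⟩ _
  constructor
  · intro h
    refine ⟨?_, fun t => by rw [h t, key]⟩
    rw [h]
    simp [hP₁0]
  -- The initial condition can be dropped: the integral equation alone determines every value of b.
  · rintro ⟨-, h⟩ t
    exact E.incl₁_injective (by rw [h t, key])

theorem continuous_nonlinearity {E : BanachTriple B₂ B₁ B} {D : Fin n → B₁ →L[ℝ] B}
    {H : ℝ → B → (Fin n → B) → P → B}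
    (hH : Continuous fun p : ℝ × B × (Fin n → B) × P => H p.1 p.2.1 p.2.2.1 p.2.2.2)
    {a T : ℝ} (haT : a ≤ T) {u : ℝ → C(Icc a T, B₁) → P}
    (hu : Continuous fun p : ℝ × C(Icc a T, B₁) => u p.1 p.2) (b : C(Icc a T, B₁)) :
    Continuous (nonlinearity E D H haT u b) := by
  have hb : Continuous fun s => b (projIcc a T haT s) := b.continuous.comp continuous_projIcc
  have h1 : Continuous fun s : ℝ => u s b := hu.comp (by fun_prop : Continuous fun s : ℝ => (s, b))
  have h2 : Continuous fun s : ℝ => (s, E.incl₁ (b (projIcc a T haT s)),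
      (fun j => D j (b (projIcc a T haT s))), u s b) := by fun_prop
  exact hH.comp h2

/-- The linear growth bound holds globally; only the Lipschitz bound is confined to the ball of
radius ρ. Both constants are uniform in a, T and u. -/
theorem exists_nonlinearity_bounds {E : BanachTriple B₂ B₁ B} {D : Fin n → B₁ →L[ℝ] B}
    {H : ℝ → B → (Fin n → B) → P → B} (hD : ∀ j, ‖D j‖ ≤ 1) (hH : HamiltonianCond H) (Lu ρ : ℝ)
    (hρ : 0 ≤ ρ) : ∃ L Λ : ℝ, 0 ≤ L ∧ 0 ≤ Λ ∧ ∀ (a T : ℝ) (haT : a ≤ T)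
      (u : ℝ → C(Icc a T, B₁) → P), (∀ t b b', ‖u t b - u t b'‖ ≤ Lu * ‖b - b'‖) →
      (∀ b s, ‖nonlinearity E D H haT u b s‖ ≤ L * ‖b‖) ∧
      (∀ b b' s, ‖b‖ ≤ ρ → ‖b'‖ ≤ ρ →
        ‖nonlinearity E D H haT u b s - nonlinearity E D H haT u b' s‖ ≤ Λ * ‖b - b'‖) := by
  obtain ⟨L, L', Lp, hL, hL', hLp, h1, h2, h3⟩ := hH.bounds
  have hDv : ∀ j v, ‖D j v‖ ≤ ‖v‖ := fun j v => by
    simpa using (D j).le_of_opNorm_le (hD j) v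
  have hsum : ∀ v : B₁, ∑ j, ‖D j v‖ ≤ n * ‖v‖ := fun v => by
    simpa using Finset.sum_le_sum (s := Finset.univ) fun j _ => hDv j v
  -- In the Lipschitz constant, the first summand comes from varying b in the B-arguments and the
  -- second from varying it in u. The absolute value is there because `Lu` has no prescribed sign.
  refine ⟨L * n, L * (1 + n) * (1 + L' * (n * ρ)) + Lp * |Lu| * (1 + n * ρ), by positivity,
    by positivity, fun a T haT u hu => ⟨fun b s => ?_, fun b b' s hb hb' => ?_⟩⟩
  · refine (h3 _ _ _ _).trans ?_
    rw [mul_assoc]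
    gcongr
    exact (hsum _).trans (by gcongr; exact b.norm_coe_le_norm _)
  · set x := projIcc a T haT s with hx
    have hbx : ‖b x‖ ≤ ρ := (b.norm_coe_le_norm x).trans hb
    have hbx' : ‖b' x‖ ≤ ρ := (b'.norm_coe_le_norm x).trans hb'
    have hdx : ‖b x - b' x‖ ≤ ‖b - b'‖ := (b - b').norm_coe_le_norm x
    have e1 : ‖H s (E.incl₁ (b x)) (fun j => D j (b x)) (u s b) -
        H s (E.incl₁ (b' x)) (fun j => D j (b' x)) (u s b)‖ ≤
        L * (1 + n) * (1 + L' * (n * ρ)) * ‖b - b'‖ := by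
      refine (h1 _ _ _ _ _ _).trans ?_
      have i1 : ‖E.incl₁ (b x) - E.incl₁ (b' x)‖ + ∑ j, ‖D j (b x) - D j (b' x)‖ ≤
          (1 + n) * ‖b - b'‖ := by
        rw [add_mul, one_mul]
        refine add_le_add ?_ ?_
        · rw [← map_sub]; exact (E.norm_incl₁_le _).trans hdx
        · simp_rw [← map_sub]
          exact (hsum _).trans (by gcongr)
      have i2 : ∑ j, ‖D j (b x)‖ ≤ n * ρ := (hsum _).trans (by gcongr)
      calc _ ≤ L * ((1 + n) * ‖b - b'‖) * (1 + L' * (n * ρ)) := by gcongr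
        _ = _ := by ring
    have e2 : ‖H s (E.incl₁ (b' x)) (fun j => D j (b' x)) (u s b) -
        H s (E.incl₁ (b' x)) (fun j => D j (b' x)) (u s b')‖ ≤
        Lp * |Lu| * (1 + n * ρ) * ‖b - b'‖ := by
      refine (h2 _ _ _ _ _).trans ?_
      have i1 : ‖u s b - u s b'‖ ≤ |Lu| * ‖b - b'‖ :=
        (hu s b b').trans (by gcongr; exact le_abs_self Lu)
      have i2 : ∑ j, ‖D j (b' x)‖ ≤ n * ρ := (hsum _).trans (by gcongr)
      calc _ ≤ Lp * (|Lu| * ‖b - b'‖) * (1 + n * ρ) := by gcongr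
        _ = _ := by ring
    rw [add_mul]
    refine le_trans ?_ (add_le_add e1 e2)
    refine le_trans (le_of_eq ?_) (norm_add_le _ _)
    rw [sub_add_sub_cancel]
    rfl

theorem isMildSolution_iff {E : BanachTriple B₂ B₁ B} {D : Fin n → B₁ →L[ℝ] B} {A : B₂ →L[ℝ] B}
    {S : C0Semigroup B} {S₁ : C0Semigroup B₁} {H : ℝ → B → (Fin n → B) → P → B}
    {R : ℝ → B → B₁} {κ ω μ : ℝ} (hA : GeneratesOnTriple E A S S₁)
    (hR : IsSmoothingFamily E S R κ ω μ) {a T : ℝ} (haT : a ≤ T) (hT : T ≤ a + 1)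
    {u : ℝ → C(Icc a T, B₁) → P} {Y : B₁} {b : C(Icc a T, B₁)}
    (hN : Continuous (nonlinearity E D H haT u b)) {Q : ℝ}
    (hQ : ∀ s, ‖nonlinearity E D H haT u b s‖ ≤ Q) :
    IsVolterraSolution (fun t v => S₁.op t v) R (nonlinearity E D H haT u) Y b ↔
      IsMildSolution E D S H haT u Y b :=
  isVolterraSolution_iff (E := E) (P₀ := fun t v => S.op t v) (K₀ := fun t v => S.op t v)
    hR.singularKernel (fun t ht v => hA.restrict t ht.1 v) (fun v => by simp [S₁.op_zero])
    (fun t ht v => hR.incl t ht.1 v) haT hT hN hQ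

theorem incl_mittagLeffler {E : BanachTriple B₂ B₁ B} {A : B₂ →L[ℝ] B}
    {S : C0Semigroup B} {S₁ : C0Semigroup B₁} (hA : GeneratesOnTriple E A S S₁) {β : ℝ}
    (hβ₀ : 0 < β) (hβ₁ : β < 1) {τ : ℝ} (hτ : τ ∈ Icc (0 : ℝ) 1) (v : B₁) :
    E.incl₁ (mittagLeffler S₁ β τ v) = mittagLeffler S β τ (E.incl₁ v) := by
  rw [mittagLeffler_eq, mittagLeffler_eq, map_smul, ← ContinuousLinearMap.integral_comp_comm _
    (integrableOn_wrightWeight_smul hβ₀ hβ₁ S₁ hA.growth₁ hτ v)]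
  congr 1
  refine setIntegral_congr_fun measurableSet_Ioi fun x (hx : 0 < x) => ?_
  simp only [map_smul]
  rw [hA.restrict _ (mul_nonneg hτ.1 hx.le)]

theorem isFractionalMildSolution_iff {E : BanachTriple B₂ B₁ B} {D : Fin n → B₁ →L[ℝ] B}
    {A : B₂ →L[ℝ] B} {S : C0Semigroup B} {S₁ : C0Semigroup B₁}
    {H : ℝ → B → (Fin n → B) → P → B} {R : ℝ → B → B₁} {κ ω μ : ℝ}
    (hA : GeneratesOnTriple E A S S₁) (hR : IsSmoothingFamily E S R κ ω μ) {β : ℝ}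
    (hβ₀ : 0 < β) (hβ₁ : β < 1) {a T : ℝ} (haT : a ≤ T) (hT : T ≤ a + 1)
    {u : ℝ → C(Icc a T, B₁) → P} {Y : B₁} {b : C(Icc a T, B₁)}
    (hN : Continuous (nonlinearity E D H haT u b)) {Q : ℝ}
    (hQ : ∀ s, ‖nonlinearity E D H haT u b s‖ ≤ Q) :
    IsVolterraSolution (fun t => mittagLeffler S₁ β (t ^ β)) (fractionalKernel R β)
        (nonlinearity E D H haT u) Y b ↔
      IsFractionalMildSolution E D S β H haT u Y b := by
  obtain ⟨C, hK⟩ := hR.exists_singularKernel_fractionalKernel hβ₀ hβ₁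
  rw [isVolterraSolution_iff (E := E) (P₀ := fun t => mittagLeffler S β (t ^ β))
    (K₀ := fun t v => β • t ^ (β - 1) • mittagLefflerDeriv S β (t ^ β) v) hK
    (fun t ht v => incl_mittagLeffler hA hβ₀ hβ₁ ⟨Real.rpow_nonneg ht.1 _,
      Real.rpow_le_one ht.1 ht.2 hβ₀.le⟩ v)
    (fun v => by rw [Real.zero_rpow hβ₀.ne', mittagLeffler_zero hβ₀ hβ₁])
    (fun t ht v => hR.incl_fractionalKernel hβ₀ hβ₁ ht v) haT hT hN hQ]
  simp_rw [intervalIntegral.integral_smul]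
  rfl

end MildSolutions

/-! ### Conclusion for both equations -/

theorem mainTheorem3 {B₂ B₁ B P : Type*}
    [NormedAddCommGroup B₂] [NormedSpace ℝ B₂] [CompleteSpace B₂]
    [NormedAddCommGroup B₁] [NormedSpace ℝ B₁] [CompleteSpace B₁]
    [NormedAddCommGroup B] [NormedSpace ℝ B] [CompleteSpace B]
    [NormedAddCommGroup P] [NormedSpace ℝ P] [CompleteSpace P]
    {n : ℕ} (E : BanachTriple B₂ B₁ B) (D : Fin n → B₁ →L[ℝ] B) (A : B₂ →L[ℝ] B)
    (S : C0Semigroup B) (S₁ : C0Semigroup B₁) (H : ℝ → B → (Fin n → B) → P → B)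
    (hA : ConditionsA E D A S S₁ H) (hS : IsSmoothing E S)
    (β : ℝ) (hβ₀ : 0 < β) (hβ₁ : β < 1) (a : ℝ) (Lu : ℝ) (r : ℝ) (hr : 0 < r) :
    ∃ T₀ K : ℝ, a < T₀ ∧ 0 ≤ K ∧ ∀ (T : ℝ) (haT : a < T), T < T₀ →
      ∀ u : ℝ → C(Set.Icc a T, B₁) → P,
        Continuous (fun p : ℝ × C(Set.Icc a T, B₁) => u p.1 p.2) →
        (∀ t b b', ‖u t b - u t b'‖ ≤ Lu * ‖b - b'‖) →
        ((∀ Y : B₁, ‖Y‖ ≤ r → ∃! b, IsMildSolution E D S H haT.le u Y b) ∧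
          (∀ Y Y' b b', ‖Y‖ ≤ r → ‖Y'‖ ≤ r →
            IsMildSolution E D S H haT.le u Y b → IsMildSolution E D S H haT.le u Y' b' →
            ‖b - b'‖ ≤ K * ‖Y - Y'‖)) ∧
        ((∀ Y : B₁, ‖Y‖ ≤ r → ∃! b, IsFractionalMildSolution E D S β H haT.le u Y b) ∧
          (∀ Y Y' b b', ‖Y‖ ≤ r → ‖Y'‖ ≤ r →
            IsFractionalMildSolution E D S β H haT.le u Y b →
            IsFractionalMildSolution E D S β H haT.le u Y' b' →
            ‖b - b'‖ ≤ K * ‖Y - Y'‖)) := by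
  obtain ⟨R, κ, ω, μ, hR⟩ := exists_isSmoothingFamily hA.semigroup hS
  obtain ⟨M₁, m₁, hM₁, hm₁, hg₁⟩ := hA.semigroup.growth₁
  have hP := S₁.boundedPropagator hM₁ hm₁ hg₁
  obtain ⟨C₂, hP'⟩ := exists_boundedPropagator_mittagLeffler hβ₀ hβ₁ S₁ hA.semigroup.growth₁
  have hK := hR.singularKernel
  obtain ⟨C₄, hK'⟩ := hR.exists_singularKernel_fractionalKernel hβ₀ hβ₁
  -- One constant for both propagators and both kernels gives a common ball and a common Lipschitz
  -- constant 2C. It is fixed before the radius 2Cr, which determines Λ and then the interval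
  -- lengths, so the choices are not circular.
  obtain ⟨C, h1, h2, h3, h4⟩ : ∃ C, M₁ * Real.exp m₁ ≤ C ∧ C₂ ≤ C ∧ κ * Real.exp μ ≤ C ∧ C₄ ≤ C :=
    ⟨max (max (M₁ * Real.exp m₁) C₂) (max (κ * Real.exp μ) C₄), by simp, by simp, by simp, by simp⟩
  have hC : 0 ≤ C := hK'.nonneg.trans h4
  obtain ⟨L, Λ, hL, hΛ, hbd⟩ := exists_nonlinearity_bounds (E := E) hA.norm_D_le hA.hamiltonian
    Lu (2 * (C * r)) (by positivity)
  obtain ⟨δ, hδ, hδ1, hsol⟩ := volterra_wellPosed (r := r) (hP.mono h1) (hK.mono h3) L Λ hL hΛ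
  obtain ⟨δ', hδ', -, hsol'⟩ := volterra_wellPosed (r := r) (hP'.mono h2) (hK'.mono h4) L Λ hL hΛ
  refine ⟨a + min δ δ', 2 * C, by linarith [lt_min hδ hδ'], by positivity,
    fun T haT hT u hu huL => ?_⟩
  have hTδ : T ≤ a + δ := by linarith [min_le_left δ δ']
  have hTδ' : T ≤ a + δ' := by linarith [min_le_right δ δ']
  have hN := continuous_nonlinearity (E := E) (D := D) hA.hamiltonian.continuous haT.le hu
  obtain ⟨hNL, hNΛ⟩ := hbd a T haT.le u huL
  have hs := hsol a T haT.le hTδ _ hN hNL hNΛ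
  have hs' := hsol' a T haT.le hTδ' _ hN hNL hNΛ
  have hiff := fun Y b => isMildSolution_iff (Y := Y) hA.semigroup hR haT.le
    (hTδ.trans (by linarith)) (hN b) (hNL b)
  have hiff' := fun Y b => isFractionalMildSolution_iff (Y := Y) hA.semigroup hR hβ₀ hβ₁ haT.le
    (hTδ.trans (by linarith)) (hN b) (hNL b)
  simp_rw [hiff] at hs
  simp_rw [hiff'] at hs'
  exact ⟨hs, hs'⟩
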